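/- For an open set $G\subset\mathbb R^d$ let $W^{2,2}(G)$ be the second-order $L^2$-Sobolev space, and for measurable $S\subset G$ put $\|\psi\|_S^2=\int_S|\psi|^2$. Let $B(x,r)$ be the open ball. There are an absolute constant $K_\Delta\in(0,\infty)$ and, for every $d$, constants $C_2,C_3\in[1,\infty)$ depending only on the dimension $d$, with the following property. Let $K_V,D_0,R,\beta\in[0,\infty)$ and $\delta\in(0,1]$ with $\delta<4R$. There exists a constant $C_{qUC}=C_{qUC}(d,K_V,D_0,R,\delta,\beta)>0$ such that, for any open $G\subset\mathbb R^d$, any $x\in G$, any measurable $\Theta\subset G$ with $$\operatorname{diam}\Theta\le R=\operatorname{dist}(x,\Theta)\quad\text{and}\quad B(x,12R+2D_0)\subset G,$$ any measurable $V\colon G\to[-K_V,K_V]$ and any real-valued $\psi\in W^{2,2}(G)$ satisfying $$|\Delta\psi|\le|V\psi|\ \text{ a.e. on } G\quad\text{and}\quad \frac{\|\psi\|_G^2}{\|\psi\|_\Theta^2}\le\beta,$$ we have $$\|\psi\|^2_{B(x,\delta)}\ge C_{qUC}\,\|\psi\|^2_\Theta .$$ Moreover, if $D_0>0$, this constant can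 be chosen such that $$C_{qUC}\ \ge\ \frac{5}{16}\,\frac1{41}\,\frac{C_2^3}{C_3K_\Delta^4}\,\frac{\delta^4}{R^2}\left(\frac{\delta}{48R}\right)^{2\alpha}\frac1{1+K_V^2}$$ for every $\alpha$ with $$\alpha\ge C_2,\qquad \alpha\ge\left(24^5C_3K_V^2R^4\right)^{1/3},\qquad 2\alpha\ge\ln\!\left(\left(\frac{24RK_\Delta}{D}\right)^4C_3\,\frac{1+K_V^2}{D_1^2}\,\beta\right),$$ where $D=\min(D_0,12R)$ and $D_1=\min(D,1)$ (so $D=D_0$ whenever $D_0\le 12R$). -/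

import Mathlib

open MeasureTheory
open scoped ContDiff

/-- `v` is a weak partial derivative of `u` in the `i`-th coordinate direction on the open set
`G ⊆ ℝᵈ`, tested against all smooth functions with compact support in `G`. -/
def IsWeakPartial {d : ℕ} (G : Set (EuclideanSpace ℝ (Fin d))) (i : Fin d)
    (u v : EuclideanSpace ℝ (Fin d) → ℝ) : Prop :=
  LocallyIntegrableOn u G ∧ LocallyIntegrableOn v G ∧
    ∀ φ : EuclideanSpace ℝ (Fin d) → ℝ, ContDiff ℝ ∞ φ → HasCompactSupport φ → tsupport φ ⊆ G →
      ∫ y in G, u y * fderiv ℝ φ y (EuclideanSpace.single i 1) = - ∫ y in G, v y * φ y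

/-- Membership in the Sobolev space `W^{k,2}(G)` of real-valued functions on the open set `G`. -/
def MemSobolevTwo {d : ℕ} (G : Set (EuclideanSpace ℝ (Fin d))) :
    ℕ → (EuclideanSpace ℝ (Fin d) → ℝ) → Prop
  | 0, u => MemLp u 2 (volume.restrict G)
  | k + 1, u => MemLp u 2 (volume.restrict G) ∧
      ∀ i : Fin d, ∃ v, IsWeakPartial G i u v ∧ MemSobolevTwo G k v

open Classical in
/-- The weak partial derivative of `u` on `G` (unique almost everywhere on `G` where it exists;
zero if there is none). -/
noncomputable def weakPartial {d : ℕ} (G : Set (EuclideanSpace ℝ (Fin d))) (i : Fin d)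
    (u : EuclideanSpace ℝ (Fin d) → ℝ) : EuclideanSpace ℝ (Fin d) → ℝ :=
  if h : ∃ v, IsWeakPartial G i u v then h.choose else 0

/-- The weak Laplacian `∑ᵢ ∂ᵢ∂ᵢ u` on `G`. -/
noncomputable def weakLaplacian {d : ℕ} (G : Set (EuclideanSpace ℝ (Fin d)))
    (u : EuclideanSpace ℝ (Fin d) → ℝ) (y : EuclideanSpace ℝ (Fin d)) : ℝ :=
  ∑ i : Fin d, weakPartial G i (weakPartial G i u) y

/-- The squared norm `‖u‖²_S = ∫_S u²`. -/
noncomputable def sqNorm {d : ℕ} (S : Set (EuclideanSpace ℝ (Fin d)))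
    (u : EuclideanSpace ℝ (Fin d) → ℝ) : ℝ :=
  ∫ y in S, u y ^ 2

/-- The lower bounds required of the exponent `α`. -/
def AdmissibleExponent (C₂ C₃ KΔ KV D R β α : ℝ) : Prop :=
  C₂ ≤ α ∧
    (24 ^ 5 * C₃ * KV ^ 2 * R ^ 4) ^ (1 / 3 : ℝ) ≤ α ∧
    Real.log ((24 * R * KΔ / D) ^ 4 * C₃ * ((1 + KV ^ 2) / min D 1 ^ 2) * β) ≤ 2 * α

/-- The explicit lower bound for the constant, as a function of the exponent `α`. -/
noncomputable def explicitBound (C₂ C₃ KΔ KV R δ α : ℝ) : ℝ :=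
  5 / 16 * (1 / 41) * (C₂ ^ 3 / (C₃ * KΔ ^ 4)) * (δ ^ 4 / R ^ 2) *
    (δ / (48 * R)) ^ (2 * α) * (1 / (1 + KV ^ 2))

/-!
Conjugating `Δ` with the square root of the radial weight `exp (2α (s/ρ - log s))`, `s = ‖y‖`,
splits it into a symmetric and an antisymmetric part. Expanding the square and integrating by parts
along the Euler field `y · ∇` gives a Carleman estimate
`(α³ - α)/ρ ∫ w u² / ‖y‖ ≤ ∫ w ‖y‖² (Δu)²` for smooth `u` vanishing near the origin
and for `‖y‖ ≥ ρ/2`.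

Apply it to `η u` with `η` a cutoff to an annulus around the origin of inner radius comparable to
`δ` and outer radius comparable to `R`. The derivatives of `η` live on two thin annuli, where the
gradient of `u` is controlled by `u` and `Δu` through Caccioppoli's inequality, so mollification
extends the resulting inequality to `L²` functions with a distributional Laplacian in `L²`. If
`|Δψ| ≤ K |ψ|` and `α³` is large compared to `K² R⁴`, the left-hand side absorbs the potential.
The weight decreases in `s`: between radii `2R` and `9R` it drops by the factor `exp (-2α)`, which
beats `‖ψ‖²_G / ‖ψ‖²_Θ ≤ β` and absorbs the outer cutoff error. What remains bounds `‖ψ‖²_Θ` by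
`‖ψ‖²_{B(x,δ)}`, up to the quotient of the weights at the inner radius and at `2R`, which is at most
`(δ/48R)^(-2α)`.
-/

open Filter Topology Laplacian

section Calculus

variable {d : ℕ} {f g : EuclideanSpace ℝ (Fin d) → ℝ} {y : EuclideanSpace ℝ (Fin d)}

/-- The classical `i`-th partial derivative, the smooth counterpart of `IsWeakPartial`. -/
noncomputable def partialDeriv (i : Fin d) (f : EuclideanSpace ℝ (Fin d) → ℝ)
    (y : EuclideanSpace ℝ (Fin d)) : ℝ :=
  fderiv ℝ f y (EuclideanSpace.single i 1)

/-- The Euler operator `y ↦ y · ∇f(y)`, that is, `r ∂ᵣ` in polar coordinates. -/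
noncomputable def eulerDeriv (f : EuclideanSpace ℝ (Fin d) → ℝ)
    (y : EuclideanSpace ℝ (Fin d)) : ℝ :=
  fderiv ℝ f y y

lemma eulerDeriv_eq_sum (f : EuclideanSpace ℝ (Fin d) → ℝ) (y : EuclideanSpace ℝ (Fin d)) :
    eulerDeriv f y = ∑ i, y i * partialDeriv i f y := by
  have hy : ∑ i, y i • EuclideanSpace.single i (1 : ℝ) = y := by
    simpa using (EuclideanSpace.basisFun (Fin d) ℝ).sum_repr y
  conv_lhs => rw [eulerDeriv, ← hy, map_sum]
  simp only [map_smul, smul_eq_mul, hy, partialDeriv]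

lemma sum_coord_mul_self (y : EuclideanSpace ℝ (Fin d)) : ∑ i, y i * y i = ‖y‖ ^ 2 := by
  rw [EuclideanSpace.real_norm_sq_eq]
  exact Finset.sum_congr rfl fun i _ => (sq _).symm

lemma partialDeriv_add (i : Fin d) (hf : DifferentiableAt ℝ f y) (hg : DifferentiableAt ℝ g y) :
    partialDeriv i (fun z => f z + g z) y = partialDeriv i f y + partialDeriv i g y := by
  simp [partialDeriv, fderiv_fun_add hf hg]

lemma partialDeriv_sub (i : Fin d) (hf : DifferentiableAt ℝ f y) (hg : DifferentiableAt ℝ g y) :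
    partialDeriv i (fun z => f z - g z) y = partialDeriv i f y - partialDeriv i g y := by
  simp [partialDeriv, fderiv_fun_sub hf hg]

lemma partialDeriv_sum {ι : Type*} (s : Finset ι) {F : ι → EuclideanSpace ℝ (Fin d) → ℝ}
    (i : Fin d) (hF : ∀ j ∈ s, DifferentiableAt ℝ (F j) y) :
    partialDeriv i (fun z => ∑ j ∈ s, F j z) y = ∑ j ∈ s, partialDeriv i (F j) y := by
  simp [partialDeriv, fderiv_fun_sum hF]

lemma partialDeriv_mul (i : Fin d) (hf : DifferentiableAt ℝ f y) (hg : DifferentiableAt ℝ g y) :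
    partialDeriv i (fun z => f z * g z) y
      = partialDeriv i f y * g y + f y * partialDeriv i g y := by
  simp [partialDeriv, fderiv_fun_mul hf hg]
  ring

lemma eulerDeriv_sub (hf : DifferentiableAt ℝ f y) (hg : DifferentiableAt ℝ g y) :
    eulerDeriv (fun z => f z - g z) y = eulerDeriv f y - eulerDeriv g y := by
  simp [eulerDeriv, fderiv_fun_sub hf hg]

lemma eulerDeriv_sum {ι : Type*} (s : Finset ι) {F : ι → EuclideanSpace ℝ (Fin d) → ℝ}
    (hF : ∀ j ∈ s, DifferentiableAt ℝ (F j) y) :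
    eulerDeriv (fun z => ∑ j ∈ s, F j z) y = ∑ j ∈ s, eulerDeriv (F j) y := by
  simp [eulerDeriv, fderiv_fun_sum hF]

lemma eulerDeriv_mul (hf : DifferentiableAt ℝ f y) (hg : DifferentiableAt ℝ g y) :
    eulerDeriv (fun z => f z * g z) y = eulerDeriv f y * g y + f y * eulerDeriv g y := by
  simp [eulerDeriv, fderiv_fun_mul hf hg]
  ring

lemma partialDeriv_congr (i : Fin d) (h : f =ᶠ[𝓝 y] g) :
    partialDeriv i f =ᶠ[𝓝 y] partialDeriv i g :=
  h.fderiv.fun_comp (· (EuclideanSpace.single i 1))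

lemma contDiffAt_partialDeriv {m n : WithTop ℕ∞} (i : Fin d) (h : ContDiffAt ℝ n f y)
    (hmn : m + 1 ≤ n) : ContDiffAt ℝ m (partialDeriv i f) y :=
  (h.fderiv_right hmn).clm_apply contDiffAt_const

lemma contDiff_partialDeriv {m n : WithTop ℕ∞} (i : Fin d) (h : ContDiff ℝ n f)
    (hmn : m + 1 ≤ n) : ContDiff ℝ m (partialDeriv i f) :=
  contDiff_iff_contDiffAt.2 fun _ => contDiffAt_partialDeriv i h.contDiffAt hmn

lemma hasCompactSupport_partialDeriv (i : Fin d) (h : HasCompactSupport f) :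
    HasCompactSupport (partialDeriv i f) :=
  h.fderiv_apply (𝕜 := ℝ) _

lemma differentiableAt_coord (j : Fin d) :
    DifferentiableAt ℝ (fun z : EuclideanSpace ℝ (Fin d) => z j) y :=
  (EuclideanSpace.proj (𝕜 := ℝ) j).differentiableAt

lemma partialDeriv_coord (i j : Fin d) :
    partialDeriv i (fun z : EuclideanSpace ℝ (Fin d) => z j) y = if i = j then 1 else 0 := by
  have h : fderiv ℝ (fun z : EuclideanSpace ℝ (Fin d) => z j) y = EuclideanSpace.proj j :=
    (EuclideanSpace.proj (𝕜 := ℝ) j).hasFDerivAt.fderiv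
  simp [partialDeriv, h, eq_comm]

lemma partialDeriv_partialDeriv (i j : Fin d) (h : ContDiffAt ℝ 2 f y) :
    partialDeriv i (partialDeriv j f) y
      = fderiv ℝ (fderiv ℝ f) y (EuclideanSpace.single i 1) (EuclideanSpace.single j 1) := by
  have hd : DifferentiableAt ℝ (fderiv ℝ f) y :=
    (h.fderiv_right (m := 1) (by norm_num)).differentiableAt one_ne_zero
  change fderiv ℝ (fun z => fderiv ℝ f z (EuclideanSpace.single j 1)) y _ = _
  simp [fderiv_clm_apply hd (differentiableAt_const _)]

lemma partialDeriv_comm (i j : Fin d) (h : ContDiffAt ℝ 2 f y) :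
    partialDeriv i (partialDeriv j f) y = partialDeriv j (partialDeriv i f) y := by
  rw [partialDeriv_partialDeriv i j h, partialDeriv_partialDeriv j i h,
    h.isSymmSndFDerivAt (by simp)]

lemma partialDeriv_eulerDeriv (i : Fin d) (h : ContDiffAt ℝ 2 f y) :
    partialDeriv i (eulerDeriv f) y = partialDeriv i f y + eulerDeriv (partialDeriv i f) y := by
  have hd : ∀ j, DifferentiableAt ℝ (partialDeriv j f) y := fun j =>
    (contDiffAt_partialDeriv (m := 1) j h (by norm_num)).differentiableAt one_ne_zero
  have hterm : ∀ j, partialDeriv i (fun z => z j * partialDeriv j f z) y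
      = (if i = j then partialDeriv j f y else 0) + y j * partialDeriv j (partialDeriv i f) y := by
    intro j
    rw [partialDeriv_mul i (differentiableAt_coord j) (hd j), partialDeriv_coord,
      partialDeriv_comm i j h]
    split_ifs <;> simp
  rw [funext (eulerDeriv_eq_sum f),
    partialDeriv_sum _ i fun j _ => (differentiableAt_coord j).fun_mul (hd j)]
  simp_rw [hterm, Finset.sum_add_distrib, ← eulerDeriv_eq_sum]
  simp

lemma laplacian_eq_sum_partialDeriv (h : ContDiffAt ℝ 2 f y) :
    Δ f y = ∑ i, partialDeriv i (partialDeriv i f) y := by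
  rw [InnerProductSpace.laplacian_eq_iteratedFDeriv_orthonormalBasis f
    (EuclideanSpace.basisFun (Fin d) ℝ)]
  simp [iteratedFDeriv_two_apply, partialDeriv_partialDeriv _ _ h]

lemma contDiff_laplacian {m n : WithTop ℕ∞} (h : ContDiff ℝ n f) (hmn : m + 2 ≤ n) :
    ContDiff ℝ m (Δ f) := by
  have hsum : Δ f = fun y => ∑ i, partialDeriv i (partialDeriv i f) y :=
    funext fun _ => laplacian_eq_sum_partialDeriv (h.of_le (le_add_self.trans hmn)).contDiffAt
  have hmn' : m + 1 + 1 ≤ n := by rwa [add_assoc, one_add_one_eq_two]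
  rw [hsum]
  exact ContDiff.sum fun i _ => contDiff_partialDeriv i (contDiff_partialDeriv i h hmn') le_rfl

lemma laplacian_eventuallyEq_zero (h : f =ᶠ[𝓝 y] 0) : Δ f =ᶠ[𝓝 y] 0 := by
  filter_upwards [eventually_eventually_nhds.2 h] with z hz
  rw [(InnerProductSpace.laplacian_congr_nhds hz).self_of_nhds]
  exact congrFun (InnerProductSpace.laplacian_const (c := (0 : ℝ))) z

lemma hasCompactSupport_laplacian (h : HasCompactSupport f) : HasCompactSupport (Δ f) :=
  HasCompactSupport.intro h fun _ hy =>
    (laplacian_eventuallyEq_zero (notMem_tsupport_iff_eventuallyEq.1 hy)).self_of_nhds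

lemma laplacian_mul (hf : ContDiffAt ℝ 2 f y) (hg : ContDiffAt ℝ 2 g y) :
    Δ (fun z => f z * g z) y
      = f y * Δ g y + 2 * ∑ i, partialDeriv i f y * partialDeriv i g y + g y * Δ f y := by
  rw [laplacian_eq_sum_partialDeriv (hf.mul hg), laplacian_eq_sum_partialDeriv hf,
    laplacian_eq_sum_partialDeriv hg, Finset.mul_sum, Finset.mul_sum, Finset.mul_sum,
    ← Finset.sum_add_distrib, ← Finset.sum_add_distrib]
  refine Finset.sum_congr rfl fun i _ => ?_
  have hprod : partialDeriv i (fun z => f z * g z)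
      =ᶠ[𝓝 y] fun z => partialDeriv i f z * g z + f z * partialDeriv i g z := by
    filter_upwards [hf.eventually (by simp), hg.eventually (by simp)] with z hfz hgz
    exact partialDeriv_mul i (hfz.differentiableAt two_ne_zero) (hgz.differentiableAt two_ne_zero)
  have df := hf.differentiableAt two_ne_zero
  have dg := hg.differentiableAt two_ne_zero
  have df' := (contDiffAt_partialDeriv (m := 1) i hf (by norm_num)).differentiableAt one_ne_zero
  have dg' := (contDiffAt_partialDeriv (m := 1) i hg (by norm_num)).differentiableAt one_ne_zero
  rw [(partialDeriv_congr i hprod).self_of_nhds,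
    partialDeriv_add i (df'.fun_mul dg) (df.fun_mul dg'), partialDeriv_mul i df' dg,
    partialDeriv_mul i df dg']
  ring

lemma integral_partialDeriv_eq_zero (i : Fin d) (h : ContDiff ℝ 1 f) (hc : HasCompactSupport f) :
    ∫ y, partialDeriv i f y = 0 := by
  have hi : Integrable (partialDeriv i f) :=
    (contDiff_partialDeriv (m := 0) i h (by simp)).continuous.integrable_of_hasCompactSupport
      (hasCompactSupport_partialDeriv i hc)
  have hf : Integrable f := h.continuous.integrable_of_hasCompactSupport hc
  have hparts := integral_mul_fderiv_eq_neg_fderiv_mul_of_integrable (μ := volume)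
    (f := fun _ : EuclideanSpace ℝ (Fin d) => (1 : ℝ)) (g := f)
    (v := EuclideanSpace.single i (1 : ℝ)) (by simp)
    (by simp only [one_mul]; exact hi) (by simpa using hf)
    (fun _ _ => differentiableAt_const _) (fun _ _ => h.differentiable one_ne_zero _)
  simpa [partialDeriv] using hparts

lemma integral_sum_partialDeriv_eq_zero {X : Fin d → EuclideanSpace ℝ (Fin d) → ℝ}
    (h : ∀ i, ContDiff ℝ 1 (X i)) (hc : ∀ i, HasCompactSupport (X i)) :
    ∫ y, ∑ i, partialDeriv i (X i) y = 0 := by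
  rw [integral_finsetSum _ fun i _ =>
    (contDiff_partialDeriv (m := 0) i (h i) (by simp)).continuous.integrable_of_hasCompactSupport
      (hasCompactSupport_partialDeriv i (hc i))]
  exact Finset.sum_eq_zero fun i _ => integral_partialDeriv_eq_zero i (h i) (hc i)

end Calculus

section Radial

variable {d : ℕ} {y : EuclideanSpace ℝ (Fin d)} {A A' : ℝ → ℝ} {a b : ℝ}

/-- `ContDiffAt.norm` over the scalar field `ℝ`, which `fun_prop` cannot infer by itself. -/
@[fun_prop]
lemma contDiffAt_norm_of_ne {E F : Type*} [NormedAddCommGroup E] [NormedSpace ℝ E]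
    [NormedAddCommGroup F] [InnerProductSpace ℝ F] {n : WithTop ℕ∞} {f : E → F} {x : E}
    (hf : ContDiffAt ℝ n f x) (hx : f x ≠ 0) : ContDiffAt ℝ n (fun z => ‖f z‖) x :=
  hf.norm ℝ hx

lemma partialDeriv_radial (i : Fin d) (hy : y ≠ 0) (hA : HasDerivAt A a ‖y‖) :
    partialDeriv i (fun z => A ‖z‖) y = a * (y i / ‖y‖) := by
  have hdn : DifferentiableAt ℝ (fun z : EuclideanSpace ℝ (Fin d) => ‖z‖) y :=
    (contDiffAt_norm ℝ hy (n := 1)).differentiableAt one_ne_zero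
  have hnorm : fderiv ℝ (fun z : EuclideanSpace ℝ (Fin d) => ‖z‖) y (EuclideanSpace.single i 1)
      = y i / ‖y‖ := by
    have hsq := congrArg (· (EuclideanSpace.single i (1 : ℝ)))
      ((hdn.hasFDerivAt.pow 2).unique (hasStrictFDerivAt_norm_sq y).hasFDerivAt)
    simp [EuclideanSpace.inner_single_right] at hsq
    rw [eq_div_iff (norm_ne_zero_iff.2 hy)]
    linarith
  have hcomp : fderiv ℝ (fun z : EuclideanSpace ℝ (Fin d) => A ‖z‖) y = _ :=
    (hA.comp_hasFDerivAt y hdn.hasFDerivAt).fderiv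
  simp [partialDeriv, hcomp, hnorm]

lemma differentiableAt_radial (hy : y ≠ 0) (hA : HasDerivAt A a ‖y‖) :
    DifferentiableAt ℝ (fun z : EuclideanSpace ℝ (Fin d) => A ‖z‖) y :=
  hA.differentiableAt.comp y ((contDiffAt_norm ℝ hy (n := 1)).differentiableAt one_ne_zero)

lemma eulerDeriv_radial (hy : y ≠ 0) (hA : HasDerivAt A a ‖y‖) :
    eulerDeriv (fun z => A ‖z‖) y = a * ‖y‖ := by
  have hterm : ∀ i, y i * (a * (y i / ‖y‖)) = a / ‖y‖ * (y i * y i) := fun i => by ring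
  simp_rw [eulerDeriv_eq_sum, partialDeriv_radial _ hy hA, hterm, ← Finset.mul_sum,
    sum_coord_mul_self]
  field_simp [norm_ne_zero_iff.2 hy]

lemma laplacian_radial (hy : y ≠ 0) (hA : ContDiffAt ℝ 2 A ‖y‖)
    (hA' : ∀ᶠ s in 𝓝 ‖y‖, HasDerivAt A (A' s) s) (hb : HasDerivAt A' b ‖y‖) :
    Δ (fun z : EuclideanSpace ℝ (Fin d) => A ‖z‖) y = b + (d - 1) / ‖y‖ * A' ‖y‖ := by
  have hr : ‖y‖ ≠ 0 := norm_ne_zero_iff.2 hy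
  have hquot : HasDerivAt (fun s => A' s / s) (b / ‖y‖ - A' ‖y‖ / ‖y‖ ^ 2) ‖y‖ := by
    refine (hb.div (hasDerivAt_id' _) hr).congr_deriv ?_
    field_simp
  have hsecond : ∀ i, partialDeriv i (partialDeriv i fun z => A ‖z‖) y
      = (b / ‖y‖ ^ 2 - A' ‖y‖ / ‖y‖ ^ 3) * (y i * y i) + A' ‖y‖ / ‖y‖ := by
    intro i
    have hfirst : partialDeriv i (fun z => A ‖z‖) =ᶠ[𝓝 y] fun z => A' ‖z‖ / ‖z‖ * z i := by
      filter_upwards [isOpen_ne.mem_nhds hy, continuous_norm.continuousAt.eventually hA']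
        with z hz hAz
      rw [partialDeriv_radial i hz hAz]
      ring
    rw [(partialDeriv_congr i hfirst).self_of_nhds,
      partialDeriv_mul i (differentiableAt_radial hy hquot) (differentiableAt_coord i),
      partialDeriv_radial i hy hquot, partialDeriv_coord, if_pos rfl]
    field_simp
  rw [laplacian_eq_sum_partialDeriv (f := fun z => A ‖z‖) (hA.comp y (contDiffAt_norm ℝ hy))]
  simp_rw [hsecond, Finset.sum_add_distrib, ← Finset.mul_sum, sum_coord_mul_self]
  simp only [Finset.sum_const, Finset.card_univ, Fintype.card_fin, nsmul_eq_mul]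
  field_simp
  ring

lemma hasDerivAt_pow_inv (d : ℕ) {s : ℝ} (hs : s ≠ 0) :
    HasDerivAt (fun s : ℝ => (s ^ d)⁻¹) (-(d : ℝ) * (s ^ d)⁻¹ / s) s := by
  refine ((hasDerivAt_pow d s).inv (pow_ne_zero d hs)).congr_deriv ?_
  rcases d with _ | d
  · simp
  · simp only [Nat.add_sub_cancel, pow_succ]
    field_simp

end Radial

section Punctured

variable {d : ℕ} {F G q : EuclideanSpace ℝ (Fin d) → ℝ} {y : EuclideanSpace ℝ (Fin d)}

/-- The test functions of the Carleman estimate: smooth functions with compact support in the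
punctured space `ℝᵈ ∖ {0}`. -/
structure IsPuncturedTest {d : ℕ} (F : EuclideanSpace ℝ (Fin d) → ℝ) : Prop where
  contDiff : ContDiff ℝ ∞ F
  eventuallyEq_zero : F =ᶠ[𝓝 0] 0
  hasCompactSupport : HasCompactSupport F

namespace IsPuncturedTest

lemma mul_left (hF : IsPuncturedTest F)
    (hq : ∀ y ≠ 0, ContDiffAt ℝ ∞ q y := by
      intro _ hy; fun_prop (disch := simp [hy])) :
    IsPuncturedTest (fun y => q y * F y) := by
  have hzero : (fun y => q y * F y) =ᶠ[𝓝 0] 0 := by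
    filter_upwards [hF.eventuallyEq_zero] with y hy
    simp [hy]
  refine ⟨contDiff_iff_contDiffAt.2 fun y => ?_, hzero, hF.hasCompactSupport.mul_left⟩
  rcases eq_or_ne y 0 with rfl | hy
  · exact (contDiffAt_const (c := (0 : ℝ))).congr_of_eventuallyEq hzero
  · exact (hq y hy).mul hF.contDiff.contDiffAt

lemma mul (hF : IsPuncturedTest F) (hG : IsPuncturedTest G) :
    IsPuncturedTest (fun y => F y * G y) :=
  hG.mul_left fun _ _ => hF.contDiff.contDiffAt

lemma pow_two (hF : IsPuncturedTest F) : IsPuncturedTest (fun y => F y ^ 2) := by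
  simpa only [sq] using hF.mul hF

lemma add (hF : IsPuncturedTest F) (hG : IsPuncturedTest G) :
    IsPuncturedTest (fun y => F y + G y) := by
  refine ⟨hF.contDiff.add hG.contDiff, ?_, hF.hasCompactSupport.add hG.hasCompactSupport⟩
  filter_upwards [hF.eventuallyEq_zero, hG.eventuallyEq_zero] with y hFy hGy
  simp [hFy, hGy]

lemma sub (hF : IsPuncturedTest F) (hG : IsPuncturedTest G) :
    IsPuncturedTest (fun y => F y - G y) := by
  simpa [sub_eq_add_neg] using hF.add (hG.mul_left (q := fun _ => -1))

lemma sum {ι : Type*} (s : Finset ι) {F : ι → EuclideanSpace ℝ (Fin d) → ℝ}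
    (hF : ∀ i, IsPuncturedTest (F i)) : IsPuncturedTest (fun y => ∑ i ∈ s, F i y) := by
  classical
  induction s using Finset.induction_on with
  | empty => exact ⟨contDiff_const, EventuallyEq.rfl, HasCompactSupport.zero⟩
  | insert i s hi ih => simpa only [Finset.sum_insert hi] using (hF i).add ih

lemma contDiffAt (hF : IsPuncturedTest F) (n : ℕ) : ContDiffAt ℝ n F y :=
  (hF.contDiff.of_le (by exact_mod_cast le_top)).contDiffAt

lemma differentiableAt (hF : IsPuncturedTest F) : DifferentiableAt ℝ F y :=
  (hF.contDiffAt 1).differentiableAt one_ne_zero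

lemma integrable (hF : IsPuncturedTest F) : Integrable F :=
  hF.contDiff.continuous.integrable_of_hasCompactSupport hF.hasCompactSupport

lemma apply_zero (hF : IsPuncturedTest F) : F 0 = 0 :=
  hF.eventuallyEq_zero.self_of_nhds

lemma partialDeriv (hF : IsPuncturedTest F) (i : Fin d) :
    IsPuncturedTest (partialDeriv i F) := by
  refine ⟨contDiff_partialDeriv i hF.contDiff le_rfl, ?_,
    hasCompactSupport_partialDeriv i hF.hasCompactSupport⟩
  filter_upwards [hF.eventuallyEq_zero.fderiv (𝕜 := ℝ)] with y hy
  simp [_root_.partialDeriv, hy]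

lemma eulerDeriv (hF : IsPuncturedTest F) : IsPuncturedTest (eulerDeriv F) := by
  rw [funext (eulerDeriv_eq_sum F)]
  exact sum _ fun i => (hF.partialDeriv i).mul_left

lemma laplacian (hF : IsPuncturedTest F) : IsPuncturedTest (Δ F) :=
  ⟨contDiff_laplacian hF.contDiff le_rfl, laplacian_eventuallyEq_zero hF.eventuallyEq_zero,
    hasCompactSupport_laplacian hF.hasCompactSupport⟩

end IsPuncturedTest

lemma sum_partialDeriv_radialField (hF : DifferentiableAt ℝ F y) (hy : y ≠ 0) :
    ∑ i, partialDeriv i (fun z => (‖z‖ ^ d)⁻¹ * (z i * F z)) y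
      = (‖y‖ ^ d)⁻¹ * eulerDeriv F y := by
  have hr : ‖y‖ ≠ 0 := norm_ne_zero_iff.2 hy
  have hweight := hasDerivAt_pow_inv d hr
  have hterm : ∀ i, partialDeriv i (fun z => (‖z‖ ^ d)⁻¹ * (z i * F z)) y
      = (‖y‖ ^ d)⁻¹ * (y i * partialDeriv i F y) + (‖y‖ ^ d)⁻¹ * F y
        - (d * (‖y‖ ^ d)⁻¹ * F y / ‖y‖ ^ 2) * (y i * y i) := by
    intro i
    rw [partialDeriv_mul i (differentiableAt_radial hy hweight)
        ((differentiableAt_coord i).fun_mul hF),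
      partialDeriv_mul i (differentiableAt_coord i) hF, partialDeriv_coord, if_pos rfl,
      partialDeriv_radial (A := fun s => (s ^ d)⁻¹) i hy hweight]
    field_simp
    ring
  simp_rw [hterm, Finset.sum_sub_distrib, Finset.sum_add_distrib, ← Finset.mul_sum,
    sum_coord_mul_self, ← eulerDeriv_eq_sum]
  simp only [Finset.sum_const, Finset.card_univ, Fintype.card_fin, nsmul_eq_mul]
  field_simp
  ring

lemma integral_inv_norm_pow_mul_eulerDeriv (hF : IsPuncturedTest F) :
    ∫ y, (‖y‖ ^ d)⁻¹ * eulerDeriv F y = 0 := by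
  have hX : ∀ i : Fin d, IsPuncturedTest (fun z => (‖z‖ ^ d)⁻¹ * (z i * F z)) := fun i =>
    hF.mul_left.mul_left
  have hdiv : ∀ y, (‖y‖ ^ d)⁻¹ * eulerDeriv F y
      = ∑ i, partialDeriv i (fun z => (‖z‖ ^ d)⁻¹ * (z i * F z)) y := by
    intro y
    rcases eq_or_ne y 0 with rfl | hy
    · simp [hF.eulerDeriv.apply_zero, ((hX _).partialDeriv _).apply_zero]
    · exact (sum_partialDeriv_radialField hF.differentiableAt hy).symm
  simp_rw [hdiv]
  exact integral_sum_partialDeriv_eq_zero (fun i => (hX i).contDiff.of_le (by simp))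
    fun i => (hX i).hasCompactSupport

lemma sum_partialDeriv_gradientField (hF : ContDiffAt ℝ 2 F y) (hG : DifferentiableAt ℝ G y)
    (hy : y ≠ 0) :
    ∑ i, partialDeriv i (fun z => ((‖z‖ ^ d)⁻¹ * ‖z‖ ^ 2) * (G z * partialDeriv i F z)) y
      = (‖y‖ ^ d)⁻¹ * (G y * (‖y‖ ^ 2 * Δ F y - (d - 2) * eulerDeriv F y)
        + ‖y‖ ^ 2 * ∑ i, partialDeriv i F y * partialDeriv i G y) := by
  have hr : ‖y‖ ≠ 0 := norm_ne_zero_iff.2 hy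
  have hF' : ∀ i, DifferentiableAt ℝ (partialDeriv i F) y := fun i =>
    (contDiffAt_partialDeriv (m := 1) i hF (by norm_num)).differentiableAt one_ne_zero
  have hweight : HasDerivAt (fun s : ℝ => (s ^ d)⁻¹ * s ^ 2)
      ((2 - d) * (‖y‖ ^ d)⁻¹ * ‖y‖) ‖y‖ := by
    refine ((hasDerivAt_pow_inv d hr).mul (hasDerivAt_pow 2 ‖y‖)).congr_deriv ?_
    field_simp
    push_cast
    ring
  have hterm : ∀ i,
      partialDeriv i (fun z => ((‖z‖ ^ d)⁻¹ * ‖z‖ ^ 2) * (G z * partialDeriv i F z)) y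
        = (2 - d) * (‖y‖ ^ d)⁻¹ * G y * (y i * partialDeriv i F y)
          + (‖y‖ ^ d)⁻¹ * ‖y‖ ^ 2 * G y * partialDeriv i (partialDeriv i F) y
          + (‖y‖ ^ d)⁻¹ * ‖y‖ ^ 2 * (partialDeriv i F y * partialDeriv i G y) := by
    intro i
    rw [partialDeriv_mul i (differentiableAt_radial hy hweight) (hG.fun_mul (hF' i)),
      partialDeriv_mul i hG (hF' i),
      partialDeriv_radial (A := fun s => (s ^ d)⁻¹ * s ^ 2) i hy hweight]
    field_simp
    ring
  simp_rw [hterm, Finset.sum_add_distrib, ← Finset.mul_sum, ← eulerDeriv_eq_sum,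
    laplacian_eq_sum_partialDeriv hF]
  ring

lemma integral_inv_norm_pow_mul_laplacian (hF : IsPuncturedTest F) (hG : IsPuncturedTest G) :
    ∫ y, (‖y‖ ^ d)⁻¹ * (G y * (‖y‖ ^ 2 * Δ F y - (d - 2) * eulerDeriv F y)
        + ‖y‖ ^ 2 * ∑ i, partialDeriv i F y * partialDeriv i G y) = 0 := by
  have hX : ∀ i : Fin d, IsPuncturedTest
      (fun z => ((‖z‖ ^ d)⁻¹ * ‖z‖ ^ 2) * (G z * partialDeriv i F z)) := fun i =>
    (hG.mul (hF.partialDeriv i)).mul_left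
  have hdiv : ∀ y, (‖y‖ ^ d)⁻¹ * (G y * (‖y‖ ^ 2 * Δ F y - (d - 2) * eulerDeriv F y)
        + ‖y‖ ^ 2 * ∑ i, partialDeriv i F y * partialDeriv i G y)
      = ∑ i, partialDeriv i
          (fun z => ((‖z‖ ^ d)⁻¹ * ‖z‖ ^ 2) * (G z * partialDeriv i F z)) y := by
    intro y
    rcases eq_or_ne y 0 with rfl | hy
    · simp only [((hX _).partialDeriv _).apply_zero]
      simp [hG.apply_zero]
    · exact (sum_partialDeriv_gradientField (hF.contDiffAt 2) hG.differentiableAt hy).symm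
  simp_rw [hdiv]
  exact integral_sum_partialDeriv_eq_zero (fun i => (hX i).contDiff.of_le (by simp))
    fun i => (hX i).hasCompactSupport

end Punctured

section Carleman

variable {d : ℕ} {f g : EuclideanSpace ℝ (Fin d) → ℝ} {y : EuclideanSpace ℝ (Fin d)}

/-- The skew part, with respect to the measure `‖y‖⁻ᵈ dy`, of the operator `‖y‖² Δ` conjugated by
`conjFactor`. -/
noncomputable def skewPart (α σ : ℝ) (g : EuclideanSpace ℝ (Fin d) → ℝ)
    (y : EuclideanSpace ℝ (Fin d)) : ℝ :=
  2 * (α - σ * ‖y‖) * eulerDeriv g y - σ * ‖y‖ * g y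

/-- The symmetric part, with respect to the measure `‖y‖⁻ᵈ dy`, of the operator `‖y‖² Δ`
conjugated by `conjFactor`; the conjugation produces the constant `c = (d - 2)² / 4`. -/
noncomputable def symmPart (α σ c : ℝ) (g : EuclideanSpace ℝ (Fin d) → ℝ)
    (y : EuclideanSpace ℝ (Fin d)) : ℝ :=
  ‖y‖ ^ 2 * Δ g y - (d - 2) * eulerDeriv g y + ((α - σ * ‖y‖) ^ 2 - c) * g y

/-- The potential whose Euler derivative collects those terms of `symmPart * skewPart` that
integrate to zero. -/
noncomputable def carlemanPotential (α σ c : ℝ) (g : EuclideanSpace ℝ (Fin d) → ℝ)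
    (y : EuclideanSpace ℝ (Fin d)) : ℝ :=
  (α - σ * ‖y‖) * ‖y‖ ^ 2 * ∑ i, partialDeriv i g y * partialDeriv i g y
    - (σ / 2 * ‖y‖ + (α - σ * ‖y‖) ^ 3 - c * (α - σ * ‖y‖)) * (g y * g y)

namespace IsPuncturedTest

lemma skewPart (α σ : ℝ) (hg : IsPuncturedTest g) : IsPuncturedTest (skewPart α σ g) :=
  hg.eulerDeriv.mul_left.sub hg.mul_left

lemma symmPart (α σ c : ℝ) (hg : IsPuncturedTest g) : IsPuncturedTest (symmPart α σ c g) :=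
  (hg.laplacian.mul_left.sub hg.eulerDeriv.mul_left).add hg.mul_left

lemma sum_partialDeriv_mul (hf : IsPuncturedTest f) (hg : IsPuncturedTest g) :
    IsPuncturedTest (fun y => ∑ i, _root_.partialDeriv i f y * _root_.partialDeriv i g y) :=
  IsPuncturedTest.sum _ fun i => (hf.partialDeriv i).mul (hg.partialDeriv i)

lemma carlemanPotential (α σ c : ℝ) (hg : IsPuncturedTest g) :
    IsPuncturedTest (carlemanPotential α σ c g) :=
  (hg.sum_partialDeriv_mul hg).mul_left.sub (hg.mul hg).mul_left

end IsPuncturedTest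

lemma hasDerivAt_const_sub_mul (α σ s : ℝ) :
    HasDerivAt (fun s : ℝ => α - σ * s) (-σ) s := by
  simpa using ((hasDerivAt_id s).const_mul σ).const_sub α

lemma sum_partialDeriv_mul_partialDeriv_skewPart (α σ : ℝ) (hg : ContDiffAt ℝ 2 g y)
    (hy : y ≠ 0) :
    ‖y‖ ^ 2 * ∑ i, partialDeriv i g y * partialDeriv i (skewPart α σ g) y
      = -2 * σ * ‖y‖ * eulerDeriv g y ^ 2
        + 2 * (α - σ * ‖y‖) * ‖y‖ ^ 2 * (∑ i, partialDeriv i g y * partialDeriv i g y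
          + ∑ i, partialDeriv i g y * eulerDeriv (partialDeriv i g) y)
        - σ * ‖y‖ * g y * eulerDeriv g y
        - σ * ‖y‖ * ‖y‖ ^ 2 * ∑ i, partialDeriv i g y * partialDeriv i g y := by
  have hr : ‖y‖ ≠ 0 := norm_ne_zero_iff.2 hy
  have hA : HasDerivAt (fun s : ℝ => 2 * (α - σ * s)) (2 * (-σ)) ‖y‖ :=
    (hasDerivAt_const_sub_mul α σ _).const_mul 2
  have hB : HasDerivAt (fun s : ℝ => σ * s) σ ‖y‖ := by
    simpa using (hasDerivAt_id ‖y‖).const_mul σ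
  have dA := differentiableAt_radial hy hA
  have dB := differentiableAt_radial hy hB
  have dg : DifferentiableAt ℝ g y := hg.differentiableAt two_ne_zero
  have de : DifferentiableAt ℝ (eulerDeriv g) y := by
    rw [funext (eulerDeriv_eq_sum g)]
    exact DifferentiableAt.fun_sum fun i _ => (differentiableAt_coord i).fun_mul
      ((contDiffAt_partialDeriv (m := 1) i hg (by norm_num)).differentiableAt one_ne_zero)
  have hterm : ∀ i, partialDeriv i g y * partialDeriv i (skewPart α σ g) y
      = (-2 * σ * eulerDeriv g y / ‖y‖ - σ * g y / ‖y‖) * (y i * partialDeriv i g y)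
        + (2 * (α - σ * ‖y‖) - σ * ‖y‖) * (partialDeriv i g y * partialDeriv i g y)
        + 2 * (α - σ * ‖y‖) * (partialDeriv i g y * eulerDeriv (partialDeriv i g) y) := by
    intro i
    unfold skewPart
    rw [partialDeriv_sub i (dA.fun_mul de) (dB.fun_mul dg), partialDeriv_mul i dA de,
      partialDeriv_mul i dB dg, partialDeriv_radial i hy hA, partialDeriv_radial i hy hB,
      partialDeriv_eulerDeriv i hg]
    field_simp
    ring
  simp_rw [hterm, Finset.sum_add_distrib, ← Finset.mul_sum, ← eulerDeriv_eq_sum]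
  field_simp
  ring

lemma eulerDeriv_carlemanPotential (α σ c : ℝ) (hg : IsPuncturedTest g) (hy : y ≠ 0) :
    eulerDeriv (carlemanPotential α σ c g) y
      = (2 * (α - σ * ‖y‖) * ‖y‖ ^ 2 - σ * ‖y‖ * ‖y‖ ^ 2)
          * ∑ i, partialDeriv i g y * partialDeriv i g y
        + 2 * (α - σ * ‖y‖) * ‖y‖ ^ 2
          * ∑ i, partialDeriv i g y * eulerDeriv (partialDeriv i g) y
        - (σ / 2 - 3 * σ * (α - σ * ‖y‖) ^ 2 + c * σ) * ‖y‖ * (g y * g y)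
        - (σ / 2 * ‖y‖ + (α - σ * ‖y‖) ^ 3 - c * (α - σ * ‖y‖))
          * (2 * g y * eulerDeriv g y) := by
  have hA : HasDerivAt (fun s : ℝ => (α - σ * s) * s ^ 2)
      (-σ * ‖y‖ ^ 2 + (α - σ * ‖y‖) * (2 * ‖y‖)) ‖y‖ :=
    ((hasDerivAt_const_sub_mul α σ _).mul (hasDerivAt_pow 2 ‖y‖)).congr_deriv
      (by push_cast; ring)
  have hB : HasDerivAt (fun s : ℝ => σ / 2 * s + (α - σ * s) ^ 3 - c * (α - σ * s))
      (σ / 2 - 3 * σ * (α - σ * ‖y‖) ^ 2 + c * σ) ‖y‖ :=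
    ((((hasDerivAt_id ‖y‖).const_mul (σ / 2)).add
      ((hasDerivAt_const_sub_mul α σ _).pow 3)).sub
      ((hasDerivAt_const_sub_mul α σ _).const_mul c)).congr_deriv (by push_cast; ring)
  have dA := differentiableAt_radial hy hA
  have dB := differentiableAt_radial hy hB
  have dsum := (hg.sum_partialDeriv_mul hg).differentiableAt (y := y)
  have dgg := (hg.mul hg).differentiableAt (y := y)
  have hterm : ∀ i, eulerDeriv (fun z => partialDeriv i g z * partialDeriv i g z) y
      = 2 * (partialDeriv i g y * eulerDeriv (partialDeriv i g) y) := by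
    intro i
    rw [eulerDeriv_mul (hg.partialDeriv i).differentiableAt (hg.partialDeriv i).differentiableAt]
    ring
  unfold carlemanPotential
  rw [eulerDeriv_sub (dA.fun_mul dsum) (dB.fun_mul dgg), eulerDeriv_mul dA dsum,
    eulerDeriv_mul dB dgg, eulerDeriv_radial hy hA, eulerDeriv_radial hy hB,
    eulerDeriv_mul hg.differentiableAt hg.differentiableAt,
    eulerDeriv_sum _ fun i _ => ((hg.partialDeriv i).mul (hg.partialDeriv i)).differentiableAt]
  simp_rw [hterm, ← Finset.mul_sum]
  ring

lemma symmPart_mul_skewPart (α σ c : ℝ) (hg : IsPuncturedTest g)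
    (y : EuclideanSpace ℝ (Fin d)) :
    2 * (symmPart α σ c g y * skewPart α σ g y)
      = σ * ‖y‖ * (4 * eulerDeriv g y ^ 2 + (4 * (α - σ * ‖y‖) ^ 2 - 1) * g y ^ 2)
        + 2 * (skewPart α σ g y * (‖y‖ ^ 2 * Δ g y - (d - 2) * eulerDeriv g y)
          + ‖y‖ ^ 2 * ∑ i, partialDeriv i g y * partialDeriv i (skewPart α σ g) y)
        - 2 * eulerDeriv (carlemanPotential α σ c g) y := by
  rcases eq_or_ne y 0 with rfl | hy
  · simp [hg.apply_zero, (hg.skewPart α σ).apply_zero,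
      (hg.carlemanPotential α σ c).eulerDeriv.apply_zero]
  · rw [sum_partialDeriv_mul_partialDeriv_skewPart α σ (hg.contDiffAt 2) hy,
      eulerDeriv_carlemanPotential α σ c hg hy]
    unfold symmPart skewPart
    ring

lemma integral_symmPart_mul_skewPart (α σ c : ℝ) (hg : IsPuncturedTest g) :
    ∫ y, (‖y‖ ^ d)⁻¹ * (2 * (symmPart α σ c g y * skewPart α σ g y))
      = ∫ y, (‖y‖ ^ d)⁻¹ * (σ * ‖y‖ * (4 * eulerDeriv g y ^ 2
        + (4 * (α - σ * ‖y‖) ^ 2 - 1) * g y ^ 2)) := by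
  have hskew := hg.skewPart α σ
  have hmain : Integrable fun y : EuclideanSpace ℝ (Fin d) => (‖y‖ ^ d)⁻¹ * (σ * ‖y‖ *
      (4 * eulerDeriv g y ^ 2 + (4 * (α - σ * ‖y‖) ^ 2 - 1) * g y ^ 2)) :=
    (((hg.eulerDeriv.pow_two.mul_left).add hg.pow_two.mul_left).mul_left.mul_left).integrable
  have hgrad : Integrable fun y : EuclideanSpace ℝ (Fin d) =>
      (‖y‖ ^ d)⁻¹ * (skewPart α σ g y * (‖y‖ ^ 2 * Δ g y - (d - 2) * eulerDeriv g y)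
        + ‖y‖ ^ 2 * ∑ i, partialDeriv i g y * partialDeriv i (skewPart α σ g) y) :=
    ((hskew.mul (hg.laplacian.mul_left.sub hg.eulerDeriv.mul_left)).add
      (hg.sum_partialDeriv_mul hskew).mul_left).mul_left.integrable
  have hpot : Integrable fun y : EuclideanSpace ℝ (Fin d) =>
      (‖y‖ ^ d)⁻¹ * eulerDeriv (carlemanPotential α σ c g) y :=
    (hg.carlemanPotential α σ c).eulerDeriv.mul_left.integrable
  have hweighted : ∀ y, (‖y‖ ^ d)⁻¹ * (2 * (symmPart α σ c g y * skewPart α σ g y))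
      = (‖y‖ ^ d)⁻¹ * (σ * ‖y‖ *
          (4 * eulerDeriv g y ^ 2 + (4 * (α - σ * ‖y‖) ^ 2 - 1) * g y ^ 2))
        + 2 * ((‖y‖ ^ d)⁻¹ * (skewPart α σ g y * (‖y‖ ^ 2 * Δ g y - (d - 2) * eulerDeriv g y)
          + ‖y‖ ^ 2 * ∑ i, partialDeriv i g y * partialDeriv i (skewPart α σ g) y))
        - 2 * ((‖y‖ ^ d)⁻¹ * eulerDeriv (carlemanPotential α σ c g) y) := by
    intro y
    rw [symmPart_mul_skewPart α σ c hg]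
    ring
  simp_rw [hweighted]
  rw [integral_sub (hmain.fun_add (hgrad.const_mul 2)) (hpot.const_mul 2),
    integral_add hmain (hgrad.const_mul 2), integral_const_mul, integral_const_mul,
    integral_inv_norm_pow_mul_laplacian hg hskew,
    integral_inv_norm_pow_mul_eulerDeriv (hg.carlemanPotential α σ c)]
  ring

lemma integral_symmPart_add_skewPart_sq_ge (α σ c : ℝ) (hg : IsPuncturedTest g) :
    ∫ y, (‖y‖ ^ d)⁻¹ * (σ * ‖y‖ * (4 * eulerDeriv g y ^ 2
        + (4 * (α - σ * ‖y‖) ^ 2 - 1) * g y ^ 2))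
      ≤ ∫ y, (‖y‖ ^ d)⁻¹ * (symmPart α σ c g y + skewPart α σ g y) ^ 2 := by
  have hskew := hg.skewPart α σ
  have hsymm := hg.symmPart α σ c
  rw [← integral_symmPart_mul_skewPart α σ c hg]
  refine integral_mono (hsymm.mul hskew).mul_left.mul_left.integrable
    (hsymm.add hskew).pow_two.mul_left.integrable fun y => ?_
  have hsq : 2 * (symmPart α σ c g y * skewPart α σ g y)
      ≤ (symmPart α σ c g y + skewPart α σ g y) ^ 2 := by
    linarith [sq_nonneg (symmPart α σ c g y), sq_nonneg (skewPart α σ g y),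
      add_sq (symmPart α σ c g y) (skewPart α σ g y)]
  exact mul_le_mul_of_nonneg_left hsq (by positivity)

/-- The radial profile `e^{σs} s^{-γ}` conjugating the Laplacian; by `conjFactor_sq` its square is
the Carleman weight up to powers of the radius. -/
noncomputable def conjFactor (γ σ s : ℝ) : ℝ := Real.exp (σ * s - γ * Real.log s)

lemma hasDerivAt_conjFactor (γ σ : ℝ) {s : ℝ} (hs : s ≠ 0) :
    HasDerivAt (conjFactor γ σ) (-(γ - σ * s) / s * conjFactor γ σ s) s := by
  refine (((hasDerivAt_id s).const_mul σ).sub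
    ((Real.hasDerivAt_log hs).const_mul γ)).exp.congr_deriv ?_
  simp only [conjFactor, id, Pi.sub_apply]
  field_simp
  ring

@[fun_prop]
lemma contDiffAt_conjFactor (γ σ : ℝ) {n : WithTop ℕ∞} {s : ℝ} (hs : s ≠ 0) :
    ContDiffAt ℝ n (conjFactor γ σ) s := by
  unfold conjFactor
  fun_prop (disch := assumption)

lemma laplacian_conjFactor (γ σ : ℝ) (hy : y ≠ 0) :
    Δ (fun z : EuclideanSpace ℝ (Fin d) => conjFactor γ σ ‖z‖) y
      = conjFactor γ σ ‖y‖ * ((γ - σ * ‖y‖) ^ 2 + σ * ‖y‖ - (d - 2) * (γ - σ * ‖y‖))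
        / ‖y‖ ^ 2 := by
  have hr : ‖y‖ ≠ 0 := norm_ne_zero_iff.2 hy
  have hsecond := ((hasDerivAt_const_sub_mul γ σ ‖y‖).fun_neg.fun_div (hasDerivAt_id' _) hr).fun_mul
    (hasDerivAt_conjFactor γ σ hr)
  rw [laplacian_radial hy (contDiffAt_conjFactor γ σ hr)
    ((eventually_ne_nhds hr).mono fun _ => hasDerivAt_conjFactor γ σ) hsecond]
  field_simp
  ring

lemma symmPart_add_skewPart_conjFactor_mul (α σ : ℝ) (hf : ContDiffAt ℝ 2 f y) (hy : y ≠ 0) :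
    symmPart α σ (((d : ℝ) - 2) ^ 2 / 4)
        (fun z => conjFactor (α - ((d : ℝ) - 2) / 2) σ ‖z‖ * f z) y
      + skewPart α σ (fun z => conjFactor (α - ((d : ℝ) - 2) / 2) σ ‖z‖ * f z) y
      = conjFactor (α - ((d : ℝ) - 2) / 2) σ ‖y‖ * (‖y‖ ^ 2 * Δ f y) := by
  obtain ⟨γ, rfl⟩ : ∃ γ, α = γ + ((d : ℝ) - 2) / 2 := ⟨α - ((d : ℝ) - 2) / 2, by ring⟩
  have hr : ‖y‖ ≠ 0 := norm_ne_zero_iff.2 hy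
  have hM := hasDerivAt_conjFactor γ σ hr
  have hgrad : ∀ i, partialDeriv i (fun z => conjFactor γ σ ‖z‖) y * partialDeriv i f y
      = -(γ - σ * ‖y‖) / ‖y‖ ^ 2 * conjFactor γ σ ‖y‖ * (y i * partialDeriv i f y) := by
    intro i
    rw [partialDeriv_radial i hy hM]
    field_simp
  unfold symmPart skewPart
  rw [add_sub_cancel_right, laplacian_mul (by fun_prop (disch := simp [hy])) hf,
    laplacian_conjFactor γ σ hy, eulerDeriv_mul (differentiableAt_radial hy hM)
    (hf.differentiableAt two_ne_zero), eulerDeriv_radial hy hM]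
  simp_rw [hgrad, ← Finset.mul_sum, ← eulerDeriv_eq_sum]
  field_simp
  ring

/-- The Carleman weight `w(s)^{-2α}` for the profile `w(s) = s e^{-s/ρ}`. -/
noncomputable def carlemanWeight (α ρ s : ℝ) : ℝ := Real.exp (2 * α * (s / ρ - Real.log s))

@[fun_prop]
lemma contDiffAt_carlemanWeight (α ρ : ℝ) {n : WithTop ℕ∞} {s : ℝ} (hs : s ≠ 0) :
    ContDiffAt ℝ n (carlemanWeight α ρ) s := by
  unfold carlemanWeight
  fun_prop (disch := assumption)

lemma conjFactor_sq (d : ℕ) (α ρ : ℝ) {s : ℝ} (hs : 0 < s) :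
    (s ^ d)⁻¹ * conjFactor (α - ((d : ℝ) - 2) / 2) (α / ρ) s ^ 2
      = carlemanWeight α ρ s * (s ^ 2)⁻¹ := by
  have hexp : ∀ n : ℕ, (s ^ n)⁻¹ = Real.exp (-(n * Real.log s)) := fun n => by
    rw [Real.exp_neg, Real.exp_nat_mul, Real.exp_log hs]
  rw [hexp, hexp, conjFactor, carlemanWeight, ← Real.exp_nat_mul, ← Real.exp_add,
    ← Real.exp_add]
  congr 1
  push_cast
  ring

lemma inv_norm_pow_mul_conjugated_sq (α ρ : ℝ) (hf : IsPuncturedTest f)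
    (y : EuclideanSpace ℝ (Fin d)) :
    (‖y‖ ^ d)⁻¹ * (symmPart α (α / ρ) (((d : ℝ) - 2) ^ 2 / 4)
        (fun z => conjFactor (α - ((d : ℝ) - 2) / 2) (α / ρ) ‖z‖ * f z) y
      + skewPart α (α / ρ)
        (fun z => conjFactor (α - ((d : ℝ) - 2) / 2) (α / ρ) ‖z‖ * f z) y) ^ 2
      = carlemanWeight α ρ ‖y‖ * ‖y‖ ^ 2 * Δ f y ^ 2 := by
  have hg : IsPuncturedTest
      (fun z => conjFactor (α - ((d : ℝ) - 2) / 2) (α / ρ) ‖z‖ * f z) := hf.mul_left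
  rcases eq_or_ne y 0 with rfl | hy
  · simp [(hg.skewPart _ _).apply_zero, (hg.symmPart _ _ _).apply_zero]
  · rw [symmPart_add_skewPart_conjFactor_mul α _ (hf.contDiffAt 2) hy, mul_pow, ← mul_assoc,
      conjFactor_sq d α ρ (norm_pos_iff.2 hy)]
    field_simp [norm_ne_zero_iff.2 hy]

lemma carleman_lower_bound {α ρ : ℝ} (hα : 0 ≤ α) (hρ : 0 < ρ) (hy : y ≠ 0)
    (hyρ : ‖y‖ ≤ ρ / 2) (e t : ℝ) :
    (α ^ 3 - α) / ρ * (carlemanWeight α ρ ‖y‖ * ‖y‖⁻¹ * t ^ 2)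
      ≤ (‖y‖ ^ d)⁻¹ * (α / ρ * ‖y‖ * (4 * e ^ 2 + (4 * (α - α / ρ * ‖y‖) ^ 2 - 1)
        * (conjFactor (α - ((d : ℝ) - 2) / 2) (α / ρ) ‖y‖ * t) ^ 2)) := by
  have hr : 0 < ‖y‖ := norm_pos_iff.2 hy
  have hhalf : α / 2 ≤ α - α / ρ * ‖y‖ := by
    have hdrift : α / ρ * ‖y‖ ≤ α / 2 := calc
      α / ρ * ‖y‖ ≤ α / ρ * (ρ / 2) := by gcongr
      _ = α / 2 := by field_simp
    linarith
  have hcoeff : α ^ 2 - 1 ≤ 4 * (α - α / ρ * ‖y‖) ^ 2 - 1 := by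
    linarith [pow_le_pow_left₀ (by positivity) hhalf 2, div_pow α 2 2]
  set γ := α - ((d : ℝ) - 2) / 2
  calc (α ^ 3 - α) / ρ * (carlemanWeight α ρ ‖y‖ * ‖y‖⁻¹ * t ^ 2)
      = (α / ρ * ‖y‖ * (α ^ 2 - 1) * t ^ 2) * (carlemanWeight α ρ ‖y‖ * (‖y‖ ^ 2)⁻¹) := by
        field_simp
    _ = (‖y‖ ^ d)⁻¹ * (α / ρ * ‖y‖
          * ((α ^ 2 - 1) * (conjFactor γ (α / ρ) ‖y‖ * t) ^ 2)) := by
        rw [← conjFactor_sq d α ρ hr]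
        ring
    _ ≤ _ := by
        gcongr
        linarith [mul_le_mul_of_nonneg_right hcoeff (sq_nonneg (conjFactor γ (α / ρ) ‖y‖ * t)),
          sq_nonneg e]

theorem carleman_estimate {α ρ : ℝ} (hα : 0 ≤ α) (hρ : 0 < ρ) (hf : IsPuncturedTest f)
    (hsupp : ∀ y, ρ / 2 ≤ ‖y‖ → f y = 0) :
    (α ^ 3 - α) / ρ * ∫ y, carlemanWeight α ρ ‖y‖ * ‖y‖⁻¹ * f y ^ 2
      ≤ ∫ y, carlemanWeight α ρ ‖y‖ * ‖y‖ ^ 2 * Δ f y ^ 2 := by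
  rw [← integral_const_mul]
  have hg : IsPuncturedTest
      (fun z => conjFactor (α - ((d : ℝ) - 2) / 2) (α / ρ) ‖z‖ * f z) := hf.mul_left
  have hconj := integral_symmPart_add_skewPart_sq_ge α (α / ρ) (((d : ℝ) - 2) ^ 2 / 4) hg
  simp_rw [inv_norm_pow_mul_conjugated_sq α ρ hf] at hconj
  refine le_trans (integral_mono (hf.pow_two.mul_left.integrable.const_mul _)
    ((hg.eulerDeriv.pow_two.mul_left.add hg.pow_two.mul_left).mul_left.mul_left).integrable
    fun y => ?_) hconj
  rcases eq_or_ne y 0 with rfl | hy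
  · simp
  rcases le_total ‖y‖ (ρ / 2) with hyρ | hyρ
  · exact carleman_lower_bound hα hρ hy hyρ _ _
  · simp only [hsupp y hyρ, zero_pow two_ne_zero, mul_zero, add_zero]
    positivity

end Carleman

section Caccioppoli

variable {d : ℕ} {u χ : EuclideanSpace ℝ (Fin d) → ℝ} {y : EuclideanSpace ℝ (Fin d)} {l : ℝ}

lemma partialDeriv_comp_smul (i : Fin d) (c : ℝ) (f : EuclideanSpace ℝ (Fin d) → ℝ)
    (y : EuclideanSpace ℝ (Fin d)) :
    partialDeriv i (fun z => f (c • z)) y = c * partialDeriv i f (c • y) := by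
  rw [partialDeriv, fderiv_comp_smul, partialDeriv]
  simp only [FunLike.coe_smul, Pi.smul_apply, smul_eq_mul]

lemma laplacian_comp_smul (c : ℝ) (hu : ContDiff ℝ 2 u) (y : EuclideanSpace ℝ (Fin d)) :
    Δ (fun z => u (c • z)) y = c ^ 2 * Δ u (c • y) := by
  simp only [InnerProductSpace.laplacian_eq_iteratedFDeriv_stdOrthonormalBasis,
    iteratedFDeriv_comp_const_smul c (i := 2) hu, smul_apply, smul_eq_mul, Finset.mul_sum]

/-- A smooth function equal to `1` on the unit ball and to `0` off the ball of radius `11/10`. -/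
noncomputable def modelBump (d : ℕ) : ContDiffBump (0 : EuclideanSpace ℝ (Fin d)) :=
  ⟨1, 11 / 10, by norm_num, by norm_num⟩

/-- The cutoff at radius `l`, equal to `1` for `‖y‖ ≤ l` and to `0` for `‖y‖ ≥ 11/10 l`. -/
noncomputable def cutoff (l : ℝ) (y : EuclideanSpace ℝ (Fin d)) : ℝ := modelBump d (l⁻¹ • y)

lemma contDiff_cutoff (l : ℝ) {n : ℕ∞} :
    ContDiff ℝ n (cutoff l : EuclideanSpace ℝ (Fin d) → ℝ) :=
  (modelBump d).contDiff.comp (contDiff_const_smul l⁻¹)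

lemma cutoff_nonneg (l : ℝ) (y : EuclideanSpace ℝ (Fin d)) : 0 ≤ cutoff l y :=
  (modelBump d).nonneg

lemma cutoff_le_one (l : ℝ) (y : EuclideanSpace ℝ (Fin d)) : cutoff l y ≤ 1 :=
  (modelBump d).le_one

lemma cutoff_eq_one (hl : 0 < l) (hy : ‖y‖ ≤ l) : cutoff l y = 1 := by
  refine (modelBump d).one_of_mem_closedBall ?_
  rw [mem_closedBall_zero_iff, norm_smul, norm_inv, Real.norm_of_nonneg hl.le,
    inv_mul_le_iff₀ hl]
  simpa [modelBump] using hy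

lemma cutoff_eq_zero (hl : 0 < l) (hy : 11 / 10 * l ≤ ‖y‖) : cutoff l y = 0 := by
  refine (modelBump d).zero_of_le_dist ?_
  rw [dist_zero_right, norm_smul, norm_inv, Real.norm_of_nonneg hl.le, le_inv_mul_iff₀ hl,
    mul_comm]
  exact hy

lemma hasCompactSupport_cutoff (hl : 0 < l) :
    HasCompactSupport (cutoff l : EuclideanSpace ℝ (Fin d) → ℝ) :=
  HasCompactSupport.intro (isCompact_closedBall 0 (11 / 10 * l)) fun y hy =>
    cutoff_eq_zero hl (le_of_lt (by simpa using hy))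

lemma cutoff_eventuallyEq_one (hl : 0 < l) (hy : ‖y‖ < l) : cutoff l =ᶠ[𝓝 y] fun _ => 1 := by
  filter_upwards [(isOpen_lt continuous_norm continuous_const).mem_nhds hy] with z hz
  exact cutoff_eq_one hl (le_of_lt hz)

lemma cutoff_eventuallyEq_zero (hl : 0 < l) (hy : 11 / 10 * l < ‖y‖) :
    cutoff l =ᶠ[𝓝 y] fun _ => 0 := by
  filter_upwards [(isOpen_lt continuous_const continuous_norm).mem_nhds hy] with z hz
  exact cutoff_eq_zero hl (le_of_lt hz)

lemma exists_cutoff_bound (d : ℕ) : ∃ B : ℝ, 0 ≤ B ∧ ∀ l : ℝ, 0 < l →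
    ∀ y : EuclideanSpace ℝ (Fin d),
      ∑ i, partialDeriv i (cutoff l) y ^ 2 ≤ B / l ^ 2 ∧ |Δ (cutoff l) y| ≤ B / l ^ 2 := by
  have hsmooth : ContDiff ℝ 2 (modelBump d) := (modelBump d).contDiff
  have hcompact : HasCompactSupport (modelBump d) := (modelBump d).hasCompactSupport
  have hgrad : ∀ i, ∃ P, ∀ y, ‖partialDeriv i (modelBump d) y‖ ≤ P := fun i =>
    (hasCompactSupport_partialDeriv i hcompact).exists_bound_of_continuous
      (contDiff_partialDeriv (m := 1) i hsmooth (by norm_num)).continuous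
  obtain ⟨Q, hQ⟩ := (hasCompactSupport_laplacian hcompact).exists_bound_of_continuous
    (contDiff_laplacian (m := 0) hsmooth (by norm_num)).continuous
  choose P hP using hgrad
  have hQ_nonneg : 0 ≤ Q := (norm_nonneg _).trans (hQ 0)
  refine ⟨∑ i, P i ^ 2 + Q, by positivity, fun l hl y => ⟨?_, ?_⟩⟩
  · calc ∑ i, partialDeriv i (cutoff l) y ^ 2
        = (∑ i, partialDeriv i (modelBump d) (l⁻¹ • y) ^ 2) / l ^ 2 := by
          unfold cutoff
          simp_rw [partialDeriv_comp_smul, mul_pow, ← Finset.mul_sum, inv_pow, inv_mul_eq_div]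
      _ ≤ (∑ i, P i ^ 2 + Q) / l ^ 2 := by
          gcongr ?_ / _
          refine le_add_of_le_of_nonneg (Finset.sum_le_sum fun i _ => ?_) hQ_nonneg
          exact sq_le_sq' (neg_le_of_abs_le (hP i _)) (le_of_abs_le (hP i _))
  · calc |Δ (cutoff l) y| = |Δ ⇑(modelBump d) (l⁻¹ • y)| / l ^ 2 := by
          unfold cutoff
          rw [laplacian_comp_smul _ hsmooth, abs_mul, abs_of_nonneg (by positivity), inv_pow,
            inv_mul_eq_div]
      _ ≤ (∑ i, P i ^ 2 + Q) / l ^ 2 := by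
          gcongr ?_ / _
          exact le_add_of_nonneg_of_le (Finset.sum_nonneg fun i _ => sq_nonneg _) (hQ _)

lemma integral_mul_laplacian_comm (hχ : ContDiff ℝ 2 χ) (hc : HasCompactSupport χ)
    (hu : ContDiff ℝ 2 u) : ∫ y, χ y * Δ u y = ∫ y, u y * Δ χ y := by
  have hdχ : ∀ i, ContDiff ℝ 1 (partialDeriv i χ) := fun i =>
    contDiff_partialDeriv i hχ (by norm_num)
  have hdu : ∀ i, ContDiff ℝ 1 (partialDeriv i u) := fun i =>
    contDiff_partialDeriv i hu (by norm_num)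
  have hΔχ := (contDiff_laplacian (m := 0) hχ (by norm_num)).continuous
  have hΔu := (contDiff_laplacian (m := 0) hu (by norm_num)).continuous
  have hdiv : ∀ y, χ y * Δ u y - u y * Δ χ y
      = ∑ i, partialDeriv i (fun z => χ z * partialDeriv i u z - u z * partialDeriv i χ z) y := by
    intro y
    have dχ := hχ.differentiable two_ne_zero y
    have du := hu.differentiable two_ne_zero y
    have ddχ := fun i => (hdχ i).differentiable one_ne_zero y
    have ddu := fun i => (hdu i).differentiable one_ne_zero y
    rw [laplacian_eq_sum_partialDeriv hu.contDiffAt, laplacian_eq_sum_partialDeriv hχ.contDiffAt,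
      Finset.mul_sum, Finset.mul_sum, ← Finset.sum_sub_distrib]
    refine Finset.sum_congr rfl fun i _ => ?_
    rw [partialDeriv_sub i (dχ.fun_mul (ddu i)) (du.fun_mul (ddχ i)),
      partialDeriv_mul i dχ (ddu i), partialDeriv_mul i du (ddχ i)]
    ring
  have hχ_Δu : Integrable fun y => χ y * Δ u y :=
    (hχ.continuous.mul hΔu).integrable_of_hasCompactSupport hc.mul_right
  have hu_Δχ : Integrable fun y => u y * Δ χ y :=
    (hu.continuous.mul hΔχ).integrable_of_hasCompactSupport
      (hasCompactSupport_laplacian hc).mul_left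
  rw [← sub_eq_zero, ← integral_sub hχ_Δu hu_Δχ]
  simp_rw [hdiv]
  have hu' := hu.of_le (m := 1) (by norm_num)
  have hχ' := hχ.of_le (m := 1) (by norm_num)
  exact integral_sum_partialDeriv_eq_zero
    (fun i => (hχ'.mul (hdu i)).sub (hu'.mul (hdχ i)))
    fun i => hc.mul_right.sub (hasCompactSupport_partialDeriv i hc).mul_left

lemma laplacian_sq (hu : ContDiffAt ℝ 2 u y) :
    Δ (fun z => u z ^ 2) y = 2 * (u y * Δ u y) + 2 * ∑ i, partialDeriv i u y ^ 2 := by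
  simp_rw [sq, laplacian_mul hu hu]
  ring

lemma continuous_sum_partialDeriv_sq (hu : ContDiff ℝ 1 u) :
    Continuous fun y => ∑ i, partialDeriv i u y ^ 2 :=
  continuous_finsetSum _ fun i _ =>
    (contDiff_partialDeriv (m := 0) i hu (by norm_num)).continuous.pow 2

lemma integral_mul_sum_partialDeriv_sq (hχ : ContDiff ℝ 2 χ) (hc : HasCompactSupport χ)
    (hu : ContDiff ℝ 2 u) :
    ∫ y, χ y * ∑ i, partialDeriv i u y ^ 2
      = ∫ y, (u y ^ 2 * Δ χ y / 2 - χ y * (u y * Δ u y)) := by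
  have hΔχ := (contDiff_laplacian (m := 0) hχ (by norm_num)).continuous
  have hΔu := (contDiff_laplacian (m := 0) hu (by norm_num)).continuous
  have hu_Δχ : Integrable fun y => u y ^ 2 * Δ χ y :=
    ((hu.continuous.pow 2).mul hΔχ).integrable_of_hasCompactSupport
      (hasCompactSupport_laplacian hc).mul_left
  have hχ_Δu : Integrable fun y => χ y * (u y * Δ u y) :=
    (hχ.continuous.mul (hu.continuous.mul hΔu)).integrable_of_hasCompactSupport hc.mul_right
  have hχ_grad : Integrable fun y => χ y * ∑ i, partialDeriv i u y ^ 2 :=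
    (hχ.continuous.mul (continuous_sum_partialDeriv_sq
      (hu.of_le (by norm_num)))).integrable_of_hasCompactSupport hc.mul_right
  have hcomm := integral_mul_laplacian_comm hχ hc (hu.pow 2)
  simp_rw [laplacian_sq hu.contDiffAt, mul_add, mul_left_comm _ (2 : ℝ)] at hcomm
  rw [integral_add (hχ_Δu.const_mul 2) (hχ_grad.const_mul 2), integral_const_mul,
    integral_const_mul] at hcomm
  rw [integral_sub (hu_Δχ.div_const 2) hχ_Δu, integral_div]
  linarith

lemma integrableOn_closedBall_of_continuous {F : EuclideanSpace ℝ (Fin d) → ℝ}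
    (hF : Continuous F) (r : ℝ) : IntegrableOn F (Metric.closedBall 0 r) :=
  hF.continuousOn.integrableOn_compact (isCompact_closedBall 0 r)

lemma caccioppoli_integrand_le {B a b c h : ℝ} (hl : 0 < l) (hc₀ : 0 ≤ c) (hc₁ : c ≤ 1)
    (hb : |b| ≤ B / l ^ 2) :
    a ^ 2 * b / 2 - c * (a * h) ≤ (B + 1) / l ^ 2 * (a ^ 2 + l ^ 4 * h ^ 2) := by
  have hB : 0 ≤ B / l ^ 2 := (abs_nonneg b).trans hb
  have hfirst : a ^ 2 * b / 2 ≤ B / l ^ 2 * (a ^ 2 + l ^ 4 * h ^ 2) := by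
    have hab : a ^ 2 * b ≤ a ^ 2 * (B / l ^ 2) := by
      gcongr
      exact le_of_abs_le hb
    nlinarith [mul_nonneg hB (sq_nonneg a), mul_nonneg hB (sq_nonneg (l ^ 2 * h))]
  have hsecond : -(c * (a * h)) ≤ 1 / l ^ 2 * (a ^ 2 + l ^ 4 * h ^ 2) := by
    have hah : |a * (l ^ 2 * h)| ≤ a ^ 2 + l ^ 4 * h ^ 2 :=
      abs_le.2 ⟨by nlinarith [sq_nonneg (a + l ^ 2 * h)], by nlinarith [sq_nonneg (a - l ^ 2 * h)]⟩
    have hcah : |c * (a * (l ^ 2 * h))| ≤ |a * (l ^ 2 * h)| := by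
      rw [abs_mul, abs_of_nonneg hc₀]
      exact mul_le_of_le_one_left (abs_nonneg _) hc₁
    rw [one_div_mul_eq_div, le_div_iff₀ (by positivity)]
    linarith [neg_abs_le (c * (a * (l ^ 2 * h)))]
  rw [add_div, add_mul]
  linarith

theorem caccioppoli_inequality (d : ℕ) : ∃ C : ℝ, 0 ≤ C ∧ ∀ l : ℝ, 0 < l →
    ∀ u : EuclideanSpace ℝ (Fin d) → ℝ, ContDiff ℝ 2 u →
      ∫ y in Metric.closedBall 0 l, ∑ i, partialDeriv i u y ^ 2
        ≤ C / l ^ 2 * ∫ y in Metric.closedBall 0 (11 / 10 * l), (u y ^ 2 + l ^ 4 * Δ u y ^ 2) := by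
  obtain ⟨B, hB, hbound⟩ := exists_cutoff_bound d
  refine ⟨B + 1, by positivity, fun l hl u hu => ?_⟩
  have hχ : ContDiff ℝ 2 (cutoff l : EuclideanSpace ℝ (Fin d) → ℝ) := contDiff_cutoff l (n := 2)
  have hc := hasCompactSupport_cutoff (d := d) hl
  have hu_cont := hu.continuous
  have hχ_cont := hχ.continuous
  have hΔu := (contDiff_laplacian (m := 0) hu (by norm_num)).continuous
  have hΔχ := (contDiff_laplacian (m := 0) hχ (by norm_num)).continuous
  have hgrad := continuous_sum_partialDeriv_sq (hu.of_le (m := 1) (by norm_num))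
  calc ∫ y in Metric.closedBall 0 l, ∑ i, partialDeriv i u y ^ 2
      = ∫ y in Metric.closedBall 0 l, cutoff l y * ∑ i, partialDeriv i u y ^ 2 := by
        refine setIntegral_congr_fun Metric.isClosed_closedBall.measurableSet fun y hy => ?_
        simp only [cutoff_eq_one hl (mem_closedBall_zero_iff.1 hy), one_mul]
    _ ≤ ∫ y, cutoff l y * ∑ i, partialDeriv i u y ^ 2 :=
        setIntegral_le_integral
          ((hχ_cont.mul hgrad).integrable_of_hasCompactSupport hc.mul_right)
          (Eventually.of_forall fun y =>
            mul_nonneg (cutoff_nonneg l y) (Finset.sum_nonneg fun i _ => sq_nonneg _))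
    _ = ∫ y in Metric.closedBall 0 (11 / 10 * l),
          (u y ^ 2 * Δ (cutoff l) y / 2 - cutoff l y * (u y * Δ u y)) := by
        rw [integral_mul_sum_partialDeriv_sq hχ hc hu]
        refine (setIntegral_eq_integral_of_forall_compl_eq_zero fun y hy => ?_).symm
        have hzero := cutoff_eventuallyEq_zero hl (by simpa using hy)
        rw [(laplacian_eventuallyEq_zero hzero).self_of_nhds, hzero.self_of_nhds]
        simp
    _ ≤ ∫ y in Metric.closedBall 0 (11 / 10 * l),
          (B + 1) / l ^ 2 * (u y ^ 2 + l ^ 4 * Δ u y ^ 2) :=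
        setIntegral_mono (integrableOn_closedBall_of_continuous (by fun_prop) _)
          (integrableOn_closedBall_of_continuous (by fun_prop) _) fun y =>
          caccioppoli_integrand_le hl (cutoff_nonneg l y) (cutoff_le_one l y)
            (hbound l hl y).2
    _ = _ := integral_const_mul _ _

lemma integral_sum_partialDeriv_sq_le (d : ℕ) : ∃ C : ℝ, 0 ≤ C ∧ ∀ l : ℝ, 0 < l →
    ∀ u : EuclideanSpace ℝ (Fin d) → ℝ, ContDiff ℝ 2 u →
      ∫ y in Metric.closedBall 0 (11 / 10 * l), ∑ i, partialDeriv i u y ^ 2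
        ≤ C / l ^ 2 *
          ∫ y in Metric.closedBall 0 (121 / 100 * l), (u y ^ 2 + l ^ 4 * Δ u y ^ 2) := by
  obtain ⟨C, hC, hcaccioppoli⟩ := caccioppoli_inequality d
  refine ⟨2 * C, by positivity, fun l hl u hu => ?_⟩
  have hu_cont := hu.continuous
  have hΔu := (contDiff_laplacian (m := 0) hu (by norm_num)).continuous
  refine (hcaccioppoli (11 / 10 * l) (by positivity) u hu).trans ?_
  rw [show 11 / 10 * (11 / 10 * l) = 121 / 100 * l by ring, ← integral_const_mul,
    ← integral_const_mul]
  refine setIntegral_mono (integrableOn_closedBall_of_continuous (by fun_prop) _)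
    (integrableOn_closedBall_of_continuous (by fun_prop) _) fun y => ?_
  calc C / (11 / 10 * l) ^ 2 * (u y ^ 2 + (11 / 10 * l) ^ 4 * Δ u y ^ 2)
      ≤ C / l ^ 2 * (2 * (u y ^ 2 + l ^ 4 * Δ u y ^ 2)) := by
        gcongr
        · linarith
        · nlinarith [sq_nonneg (u y), sq_nonneg (l ^ 2 * Δ u y)]
    _ = 2 * C / l ^ 2 * (u y ^ 2 + l ^ 4 * Δ u y ^ 2) := by ring

end Caccioppoli

section CutoffCarleman

variable {d : ℕ} {u : EuclideanSpace ℝ (Fin d) → ℝ} {y : EuclideanSpace ℝ (Fin d)}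
  {l l₁ l₂ α ρ : ℝ}

/-- The commutator `[Δ, χ] u = 2 ∇χ · ∇u + u Δχ` of the Laplacian with multiplication by the cutoff
`χ` at radius `l`. -/
noncomputable def cutoffCommutator (l : ℝ) (u : EuclideanSpace ℝ (Fin d) → ℝ)
    (y : EuclideanSpace ℝ (Fin d)) : ℝ :=
  2 * ∑ i, partialDeriv i (cutoff l) y * partialDeriv i u y + u y * Δ (cutoff l) y

lemma laplacian_cutoff_mul (l : ℝ) (hu : ContDiffAt ℝ 2 u y) :
    Δ (fun z => cutoff l z * u z) y = cutoff l y * Δ u y + cutoffCommutator l u y := by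
  rw [laplacian_mul (contDiff_cutoff l (n := 2)).contDiffAt hu, cutoffCommutator, add_assoc]

lemma cutoffCommutator_eq_zero (hl : 0 < l) (hy : ‖y‖ < l ∨ 11 / 10 * l < ‖y‖) :
    cutoffCommutator l u y = 0 := by
  obtain ⟨c, hconst⟩ : ∃ c, cutoff l =ᶠ[𝓝 y] fun _ => c :=
    hy.elim (⟨1, cutoff_eventuallyEq_one hl ·⟩) (⟨0, cutoff_eventuallyEq_zero hl ·⟩)
  have hgrad : ∀ i, partialDeriv i (cutoff l) y = 0 := fun i => by
    rw [(partialDeriv_congr i hconst).self_of_nhds]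
    simp [partialDeriv]
  have hlap : Δ (cutoff l) y = 0 := by
    rw [(InnerProductSpace.laplacian_congr_nhds hconst).self_of_nhds]
    simp
  simp [cutoffCommutator, hgrad, hlap]

lemma continuous_cutoffCommutator (l : ℝ) (hu : ContDiff ℝ 1 u) :
    Continuous (cutoffCommutator l u) := by
  have hχ : ContDiff ℝ 2 (cutoff l : EuclideanSpace ℝ (Fin d) → ℝ) := contDiff_cutoff l (n := 2)
  have hdχ := fun i => (contDiff_partialDeriv (m := 1) i hχ (by norm_num)).continuous
  have hdu := fun i => (contDiff_partialDeriv (m := 0) i hu (by norm_num)).continuous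
  have hΔχ := (contDiff_laplacian (m := 0) hχ (by norm_num)).continuous
  have hu_cont := hu.continuous
  unfold cutoffCommutator
  fun_prop

lemma integrable_cutoffCommutator_sq (hl : 0 < l) (hu : ContDiff ℝ 1 u) :
    Integrable fun y => cutoffCommutator l u y ^ 2 := by
  refine ((continuous_cutoffCommutator l hu).pow 2).integrable_of_hasCompactSupport <|
    HasCompactSupport.intro (isCompact_closedBall 0 (11 / 10 * l)) fun y hy => ?_
  rw [Pi.pow_apply, cutoffCommutator_eq_zero hl (Or.inr (by simpa using hy)), zero_pow two_ne_zero]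

lemma cutoffCommutator_sq_le {B : ℝ} (u : EuclideanSpace ℝ (Fin d) → ℝ)
    (hgrad : ∑ i, partialDeriv i (cutoff l) y ^ 2 ≤ B / l ^ 2)
    (hlap : |Δ (cutoff l) y| ≤ B / l ^ 2) :
    cutoffCommutator l u y ^ 2
      ≤ 8 * B / l ^ 2 * ∑ i, partialDeriv i u y ^ 2 + 2 * B ^ 2 / l ^ 4 * u y ^ 2 := by
  have hcross : (∑ i, partialDeriv i (cutoff l) y * partialDeriv i u y) ^ 2
      ≤ B / l ^ 2 * ∑ i, partialDeriv i u y ^ 2 :=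
    (Finset.sum_mul_sq_le_sq_mul_sq _ _ _).trans
      (mul_le_mul_of_nonneg_right hgrad (Finset.sum_nonneg fun i _ => sq_nonneg _))
  have hzeroth : (u y * Δ (cutoff l) y) ^ 2 ≤ (B / l ^ 2) ^ 2 * u y ^ 2 := by
    rw [mul_pow, mul_comm]
    gcongr ?_ * _
    exact sq_le_sq' (neg_le_of_abs_le hlap) (le_of_abs_le hlap)
  calc cutoffCommutator l u y ^ 2
      ≤ 2 * ((2 * ∑ i, partialDeriv i (cutoff l) y * partialDeriv i u y) ^ 2
          + (u y * Δ (cutoff l) y) ^ 2) := add_sq_le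
    _ ≤ 2 * (4 * (B / l ^ 2 * ∑ i, partialDeriv i u y ^ 2) + (B / l ^ 2) ^ 2 * u y ^ 2) := by
        rw [mul_pow]
        norm_num
        gcongr
    _ = _ := by ring

lemma integral_cutoffCommutator_sq_le (d : ℕ) : ∃ C : ℝ, 0 ≤ C ∧ ∀ l : ℝ, 0 < l →
    ∀ u : EuclideanSpace ℝ (Fin d) → ℝ, ContDiff ℝ 2 u →
      ∫ y, cutoffCommutator l u y ^ 2
        ≤ C / l ^ 4 *
          ∫ y in Metric.closedBall 0 (121 / 100 * l), (u y ^ 2 + l ^ 4 * Δ u y ^ 2) := by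
  obtain ⟨B, hB, hbound⟩ := exists_cutoff_bound d
  obtain ⟨C, hC, hgrad_le⟩ := integral_sum_partialDeriv_sq_le d
  refine ⟨8 * B * C + 2 * B ^ 2, by positivity, fun l hl u hu => ?_⟩
  let S : ℝ → Set (EuclideanSpace ℝ (Fin d)) := Metric.closedBall 0
  have hu_cont := hu.continuous
  have hΔu := (contDiff_laplacian (m := 0) hu (by norm_num)).continuous
  have hgrad := continuous_sum_partialDeriv_sq (hu.of_le (m := 1) (by norm_num))
  have hint : ∀ {F : EuclideanSpace ℝ (Fin d) → ℝ} (r : ℝ), Continuous F → IntegrableOn F (S r) :=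
    fun r hF => integrableOn_closedBall_of_continuous hF r
  have hu_le : ∫ y in S (11 / 10 * l), u y ^ 2
      ≤ ∫ y in S (121 / 100 * l), (u y ^ 2 + l ^ 4 * Δ u y ^ 2) :=
    calc ∫ y in S (11 / 10 * l), u y ^ 2
        ≤ ∫ y in S (11 / 10 * l), (u y ^ 2 + l ^ 4 * Δ u y ^ 2) :=
          setIntegral_mono (hint _ (by fun_prop)) (hint _ (by fun_prop)) fun y =>
            le_add_of_nonneg_right (by positivity)
      _ ≤ _ := setIntegral_mono_set (hint _ (by fun_prop))
          (Eventually.of_forall fun y => by positivity)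
          (Metric.closedBall_subset_closedBall (by linarith)).eventuallyLE
  calc ∫ y, cutoffCommutator l u y ^ 2
      = ∫ y in S (11 / 10 * l), cutoffCommutator l u y ^ 2 := by
        refine (setIntegral_eq_integral_of_forall_compl_eq_zero fun y hy => ?_).symm
        rw [cutoffCommutator_eq_zero hl (Or.inr (by simpa [S] using hy)), zero_pow two_ne_zero]
    _ ≤ ∫ y in S (11 / 10 * l),
          (8 * B / l ^ 2 * ∑ i, partialDeriv i u y ^ 2 + 2 * B ^ 2 / l ^ 4 * u y ^ 2) :=
        setIntegral_mono (integrable_cutoffCommutator_sq hl (hu.of_le (by norm_num))).integrableOn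
          (hint _ (by fun_prop)) fun y =>
            cutoffCommutator_sq_le u (hbound l hl y).1 (hbound l hl y).2
    _ = 8 * B / l ^ 2 * (∫ y in S (11 / 10 * l), ∑ i, partialDeriv i u y ^ 2)
        + 2 * B ^ 2 / l ^ 4 * ∫ y in S (11 / 10 * l), u y ^ 2 := by
        rw [integral_add (hint _ (by fun_prop)) (hint _ (by fun_prop)), integral_const_mul,
          integral_const_mul]
    _ ≤ 8 * B / l ^ 2
          * (C / l ^ 2 * ∫ y in S (121 / 100 * l), (u y ^ 2 + l ^ 4 * Δ u y ^ 2))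
        + 2 * B ^ 2 / l ^ 4 * ∫ y in S (121 / 100 * l), (u y ^ 2 + l ^ 4 * Δ u y ^ 2) := by
        gcongr
        exact hgrad_le l hl u hu
    _ = _ := by ring

lemma carlemanWeight_pos (α ρ s : ℝ) : 0 < carlemanWeight α ρ s := Real.exp_pos _

lemma carlemanWeight_anti {s t : ℝ} (hα : 0 ≤ α) (hs : 0 < s) (hst : s ≤ t) (ht : t ≤ ρ) :
    carlemanWeight α ρ t ≤ carlemanWeight α ρ s := by
  have ht₀ : 0 < t := hs.trans_le hst
  have hlog : 1 - s / t ≤ Real.log t - Real.log s := by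
    have hquot := Real.one_sub_inv_le_log_of_pos (div_pos ht₀ hs)
    rwa [Real.log_div ht₀.ne' hs.ne', inv_div] at hquot
  have hslope : t / ρ - s / ρ ≤ 1 - s / t :=
    calc t / ρ - s / ρ = (t - s) / ρ := by ring
      _ ≤ (t - s) / t := by gcongr
      _ = 1 - s / t := by field_simp
  refine Real.exp_le_exp.2 (mul_le_mul_of_nonneg_left ?_ (by positivity))
  linarith

/-- A cutoff to the annulus `11/10 l₁ ≤ ‖y‖ ≤ l₂`. -/
noncomputable def annulusCutoff (l₁ l₂ : ℝ) (y : EuclideanSpace ℝ (Fin d)) : ℝ :=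
  cutoff l₂ y - cutoff l₁ y

lemma annulusCutoff_eq_one (h₁ : 0 < l₁) (h₁₂ : l₁ ≤ l₂) (hy₁ : 11 / 10 * l₁ ≤ ‖y‖)
    (hy₂ : ‖y‖ ≤ l₂) : annulusCutoff l₁ l₂ y = 1 := by
  simp [annulusCutoff, cutoff_eq_zero h₁ hy₁, cutoff_eq_one (h₁.trans_le h₁₂) hy₂]

lemma annulusCutoff_eq_zero (h₁ : 0 < l₁) (h₁₂ : l₁ ≤ l₂)
    (hy : ‖y‖ ≤ l₁ ∨ 11 / 10 * l₂ ≤ ‖y‖) : annulusCutoff l₁ l₂ y = 0 := by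
  rcases hy with hy | hy
  · simp [annulusCutoff, cutoff_eq_one h₁ hy, cutoff_eq_one (h₁.trans_le h₁₂) (hy.trans h₁₂)]
  · simp [annulusCutoff, cutoff_eq_zero (h₁.trans_le h₁₂) hy,
      cutoff_eq_zero h₁ (le_trans (by linarith) hy)]

lemma isPuncturedTest_annulusCutoff (h₁ : 0 < l₁) (h₁₂ : l₁ ≤ l₂) :
    IsPuncturedTest (annulusCutoff l₁ l₂ : EuclideanSpace ℝ (Fin d) → ℝ) := by
  refine ⟨(contDiff_cutoff l₂).sub (contDiff_cutoff l₁), ?_,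
    (hasCompactSupport_cutoff (h₁.trans_le h₁₂)).sub (hasCompactSupport_cutoff h₁)⟩
  filter_upwards [Metric.ball_mem_nhds (0 : EuclideanSpace ℝ (Fin d)) h₁] with y hy
  exact annulusCutoff_eq_zero h₁ h₁₂ (Or.inl (mem_ball_zero_iff.1 hy).le)

lemma laplacian_annulusCutoff_mul (l₁ l₂ : ℝ) (hu : ContDiffAt ℝ 2 u y) :
    Δ (fun z => annulusCutoff l₁ l₂ z * u z) y
      = annulusCutoff l₁ l₂ y * Δ u y + cutoffCommutator l₂ u y - cutoffCommutator l₁ u y := by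
  have hsub : (fun z => annulusCutoff l₁ l₂ z * u z)
      = (fun z => cutoff l₂ z * u z) - fun z => cutoff l₁ z * u z :=
    funext fun z => sub_mul _ _ _
  rw [hsub, ContDiffAt.laplacian_sub ((contDiff_cutoff l₂ (n := 2)).contDiffAt.mul hu)
      ((contDiff_cutoff l₁ (n := 2)).contDiffAt.mul hu), laplacian_cutoff_mul l₂ hu,
    laplacian_cutoff_mul l₁ hu, annulusCutoff]
  ring

lemma carlemanWeight_mul_cutoffCommutator_sq_le (u : EuclideanSpace ℝ (Fin d) → ℝ) (hα : 0 ≤ α)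
    (hl : 0 < l) (hρ : 11 / 10 * l ≤ ρ) :
    carlemanWeight α ρ ‖y‖ * ‖y‖ ^ 2 * cutoffCommutator l u y ^ 2
      ≤ 5 / 4 * carlemanWeight α ρ l * l ^ 2 * cutoffCommutator l u y ^ 2 := by
  by_cases hy : ‖y‖ < l ∨ 11 / 10 * l < ‖y‖
  · simp [cutoffCommutator_eq_zero hl hy]
  push Not at hy
  have hw_pos := carlemanWeight_pos α ρ l
  have hw := carlemanWeight_anti hα hl hy.1 (hy.2.trans hρ)
  have hr : ‖y‖ ^ 2 ≤ 5 / 4 * l ^ 2 := by nlinarith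
  calc carlemanWeight α ρ ‖y‖ * ‖y‖ ^ 2 * cutoffCommutator l u y ^ 2
      ≤ carlemanWeight α ρ l * (5 / 4 * l ^ 2) * cutoffCommutator l u y ^ 2 := by gcongr
    _ = _ := by ring

/-- The error made in the Carleman estimate by a cutoff at radius `l`, where `h` stands for the
Laplacian of `u`. -/
noncomputable def cutoffError (C α ρ l : ℝ) (u h : EuclideanSpace ℝ (Fin d) → ℝ) : ℝ :=
  C * carlemanWeight α ρ l / l ^ 2 *
    ∫ y in Metric.closedBall 0 (121 / 100 * l), (u y ^ 2 + l ^ 4 * h y ^ 2)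

lemma carlemanWeight_mul_laplacian_annulusCutoff_mul_sq_le (hα : 0 ≤ α) (h₁ : 0 < l₁)
    (h₁₂ : l₁ ≤ l₂) (hρ : 11 / 10 * l₂ ≤ ρ) (hu : ContDiffAt ℝ 2 u y) :
    carlemanWeight α ρ ‖y‖ * ‖y‖ ^ 2 * Δ (fun z => annulusCutoff l₁ l₂ z * u z) y ^ 2
      ≤ 2 * (carlemanWeight α ρ ‖y‖ * ‖y‖ ^ 2 * annulusCutoff l₁ l₂ y ^ 2 * Δ u y ^ 2)
        + 5 * carlemanWeight α ρ l₁ * l₁ ^ 2 * cutoffCommutator l₁ u y ^ 2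
        + 5 * carlemanWeight α ρ l₂ * l₂ ^ 2 * cutoffCommutator l₂ u y ^ 2 := by
  have hsplit : (annulusCutoff l₁ l₂ y * Δ u y + cutoffCommutator l₂ u y
      - cutoffCommutator l₁ u y) ^ 2 ≤ 2 * (annulusCutoff l₁ l₂ y ^ 2 * Δ u y ^ 2)
        + 4 * cutoffCommutator l₁ u y ^ 2 + 4 * cutoffCommutator l₂ u y ^ 2 := by
    nlinarith [sq_nonneg (annulusCutoff l₁ l₂ y * Δ u y
      - (cutoffCommutator l₂ u y - cutoffCommutator l₁ u y)),
      sq_nonneg (cutoffCommutator l₂ u y + cutoffCommutator l₁ u y)]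
  have hw : 0 ≤ carlemanWeight α ρ ‖y‖ * ‖y‖ ^ 2 :=
    mul_nonneg (carlemanWeight_pos _ _ _).le (sq_nonneg _)
  have herr₁ := carlemanWeight_mul_cutoffCommutator_sq_le (y := y) (ρ := ρ) u hα h₁ (by linarith)
  have herr₂ := carlemanWeight_mul_cutoffCommutator_sq_le (y := y) u hα (h₁.trans_le h₁₂) hρ
  rw [laplacian_annulusCutoff_mul l₁ l₂ hu]
  linarith [mul_le_mul_of_nonneg_left hsplit hw]

lemma integrable_carlemanWeight_mul_annulusCutoff_mul_laplacian_sq (α ρ : ℝ) (h₁ : 0 < l₁)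
    (h₁₂ : l₁ ≤ l₂) (hu : ContDiff ℝ ∞ u) :
    Integrable fun y : EuclideanSpace ℝ (Fin d) =>
      carlemanWeight α ρ ‖y‖ * ‖y‖ ^ 2 * annulusCutoff l₁ l₂ y ^ 2 * Δ u y ^ 2 := by
  have hΔu := contDiff_laplacian (m := ∞) hu le_rfl
  have hηΔu : IsPuncturedTest fun y => Δ u y * annulusCutoff l₁ l₂ y :=
    (isPuncturedTest_annulusCutoff h₁ h₁₂).mul_left fun _ _ => hΔu.contDiffAt
  exact (hηΔu.pow_two.mul_left
    (q := fun y => carlemanWeight α ρ ‖y‖ * ‖y‖ ^ 2)).integrable.congr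
      (Eventually.of_forall fun y => by ring)

theorem carleman_estimate_annulusCutoff (d : ℕ) : ∃ C : ℝ, 0 ≤ C ∧ ∀ α ρ l₁ l₂ : ℝ, 0 ≤ α →
    0 < l₁ → l₁ ≤ l₂ → 11 / 10 * l₂ ≤ ρ / 2 →
    ∀ u : EuclideanSpace ℝ (Fin d) → ℝ, ContDiff ℝ ∞ u →
      (α ^ 3 - α) / ρ *
          ∫ y, carlemanWeight α ρ ‖y‖ * ‖y‖⁻¹ * annulusCutoff l₁ l₂ y ^ 2 * u y ^ 2
      ≤ 2 * (∫ y, carlemanWeight α ρ ‖y‖ * ‖y‖ ^ 2 * annulusCutoff l₁ l₂ y ^ 2 * Δ u y ^ 2)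
        + cutoffError C α ρ l₁ u (Δ u) + cutoffError C α ρ l₂ u (Δ u) := by
  obtain ⟨C, hC, hcommutator⟩ := integral_cutoffCommutator_sq_le d
  refine ⟨5 * C, by positivity, fun α ρ l₁ l₂ hα h₁ h₁₂ hl₂ u hu => ?_⟩
  have h₂ : 0 < l₂ := h₁.trans_le h₁₂
  have hu₂ : ContDiff ℝ 2 u := contDiff_infty.1 hu 2
  have hη := isPuncturedTest_annulusCutoff (d := d) h₁ h₁₂
  have hηu : IsPuncturedTest fun y => annulusCutoff l₁ l₂ y * u y := by
    simpa only [mul_comm] using hη.mul_left fun _ _ => hu.contDiffAt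
  have hcarleman := carleman_estimate hα (by linarith : 0 < ρ) hηu fun y hy => by
    rw [annulusCutoff_eq_zero h₁ h₁₂ (Or.inr (hl₂.trans hy)), zero_mul]
  have hmain := integrable_carlemanWeight_mul_annulusCutoff_mul_laplacian_sq α ρ h₁ h₁₂ hu
  have herr : ∀ l, 0 < l → Integrable fun y : EuclideanSpace ℝ (Fin d) =>
      5 * carlemanWeight α ρ l * l ^ 2 * cutoffCommutator l u y ^ 2 := fun l hl =>
    (integrable_cutoffCommutator_sq hl (hu₂.of_le (by norm_num))).const_mul _
  have herr_le : ∀ l, 0 < l →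
      ∫ y, 5 * carlemanWeight α ρ l * l ^ 2 * cutoffCommutator l u y ^ 2
        ≤ cutoffError (5 * C) α ρ l u (Δ u) := by
    intro l hl
    have hw := carlemanWeight_pos α ρ l
    rw [integral_const_mul]
    refine (mul_le_mul_of_nonneg_left (hcommutator l hl u hu₂) (by positivity)).trans_eq ?_
    rw [cutoffError, ← mul_assoc]
    field_simp
  calc (α ^ 3 - α) / ρ *
        ∫ y, carlemanWeight α ρ ‖y‖ * ‖y‖⁻¹ * annulusCutoff l₁ l₂ y ^ 2 * u y ^ 2
      ≤ ∫ y, carlemanWeight α ρ ‖y‖ * ‖y‖ ^ 2 * Δ (fun z => annulusCutoff l₁ l₂ z * u z) y ^ 2 := by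
        simpa only [mul_pow, mul_assoc] using hcarleman
    _ ≤ ∫ y, (2 * (carlemanWeight α ρ ‖y‖ * ‖y‖ ^ 2 * annulusCutoff l₁ l₂ y ^ 2 * Δ u y ^ 2)
          + 5 * carlemanWeight α ρ l₁ * l₁ ^ 2 * cutoffCommutator l₁ u y ^ 2
          + 5 * carlemanWeight α ρ l₂ * l₂ ^ 2 * cutoffCommutator l₂ u y ^ 2) :=
        integral_mono hηu.laplacian.pow_two.mul_left.integrable
          (((hmain.const_mul 2).fun_add (herr l₁ h₁)).fun_add (herr l₂ h₂)) fun y =>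
            carlemanWeight_mul_laplacian_annulusCutoff_mul_sq_le hα h₁ h₁₂ (by linarith)
              hu₂.contDiffAt
    _ ≤ _ := by
        rw [integral_add ((hmain.const_mul 2).fun_add (herr l₁ h₁)) (herr l₂ h₂),
          integral_add (hmain.const_mul 2) (herr l₁ h₁), integral_const_mul]
        linarith [herr_le l₁ h₁, herr_le l₂ h₂]

end CutoffCarleman

section Mollify

open scoped Convolution ENNReal

variable {d : ℕ} {F H φ : EuclideanSpace ℝ (Fin d) → ℝ}

/-- The convolution `F ⋆ φ` of two real functions with respect to Lebesgue measure, used with `φ`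
a smooth bump to regularise `F`. -/
noncomputable def mollify (F φ : EuclideanSpace ℝ (Fin d) → ℝ) : EuclideanSpace ℝ (Fin d) → ℝ :=
  F ⋆[ContinuousLinearMap.mul ℝ ℝ, volume] φ

/-- `H` is the Laplacian of `F` on the set `U` in the sense of distributions. -/
def HasDistribLaplacianOn (U : Set (EuclideanSpace ℝ (Fin d)))
    (F H : EuclideanSpace ℝ (Fin d) → ℝ) : Prop :=
  ∀ χ : EuclideanSpace ℝ (Fin d) → ℝ, ContDiff ℝ ∞ χ → HasCompactSupport χ → tsupport χ ⊆ U →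
    ∫ y, F y * Δ χ y = ∫ y, H y * χ y

lemma contDiff_mollify (hF : LocallyIntegrable F) (hφ : ContDiff ℝ ∞ φ)
    (hc : HasCompactSupport φ) : ContDiff ℝ ∞ (mollify F φ) :=
  hc.contDiff_convolution_right _ hF hφ

lemma partialDeriv_mollify (i : Fin d) (hF : LocallyIntegrable F) (hφ : ContDiff ℝ 1 φ)
    (hc : HasCompactSupport φ) :
    partialDeriv i (mollify F φ) = mollify F (partialDeriv i φ) := by
  funext y
  have h := hc.hasFDerivAt_convolution_right (ContinuousLinearMap.mul ℝ ℝ) hF hφ y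
  unfold partialDeriv mollify
  rw [h.fderiv, convolution_precompR_apply _ hF (hc.fderiv ℝ) (hφ.continuous_fderiv one_ne_zero)]

lemma laplacian_mollify (hF : LocallyIntegrable F) (hφ : ContDiff ℝ ∞ φ)
    (hc : HasCompactSupport φ) : Δ (mollify F φ) = mollify F (Δ φ) := by
  have hφ₁ : ∀ i, ContDiff ℝ ∞ (partialDeriv i φ) := fun i => contDiff_partialDeriv i hφ le_rfl
  have hφ₂ : ∀ i, ContDiff ℝ ∞ (partialDeriv i (partialDeriv i φ)) := fun i =>
    contDiff_partialDeriv i (hφ₁ i) le_rfl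
  have hc₁ := fun i => hasCompactSupport_partialDeriv i hc
  have hφΔ : Δ φ = fun t => ∑ i, partialDeriv i (partialDeriv i φ) t :=
    funext fun t => laplacian_eq_sum_partialDeriv (contDiff_infty.1 hφ 2).contDiffAt
  funext y
  rw [laplacian_eq_sum_partialDeriv (contDiff_infty.1 (contDiff_mollify hF hφ hc) 2).contDiffAt]
  simp_rw [fun i => partialDeriv_mollify i hF (contDiff_infty.1 hφ 1) hc,
    fun i => partialDeriv_mollify i hF (contDiff_infty.1 (hφ₁ i) 1) (hc₁ i)]
  simp only [mollify, convolution_mul, hφΔ, Finset.mul_sum]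
  exact (integral_finsetSum _ fun i _ =>
    (hasCompactSupport_partialDeriv i (hc₁ i)).convolutionExists_right
      (ContinuousLinearMap.mul ℝ ℝ) hF (hφ₂ i).continuous y).symm

lemma laplacian_comp_sub_right (f : EuclideanSpace ℝ (Fin d) → ℝ)
    (a y : EuclideanSpace ℝ (Fin d)) : Δ (fun z => f (z - a)) y = Δ f (y - a) := by
  simp only [InnerProductSpace.laplacian_eq_iteratedFDeriv_stdOrthonormalBasis,
    iteratedFDeriv_comp_sub]

lemma laplacian_comp_sub_left (hφ : ContDiff ℝ 2 φ) (a y : EuclideanSpace ℝ (Fin d)) :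
    Δ (fun z => φ (a - z)) y = Δ φ (a - y) := by
  have hreflect := laplacian_comp_sub_right (fun z => φ ((-1 : ℝ) • z)) a y
  rw [laplacian_comp_smul (-1) hφ] at hreflect
  simpa only [neg_smul, one_smul, neg_sub, neg_one_sq, one_mul] using hreflect

lemma laplacian_mollify_of_distrib {U : Set (EuclideanSpace ℝ (Fin d))}
    (hF : LocallyIntegrable F) (hFH : HasDistribLaplacianOn U F H) (hφ : ContDiff ℝ ∞ φ)
    {r : ℝ} (hr : tsupport φ ⊆ Metric.closedBall 0 r) {y : EuclideanSpace ℝ (Fin d)}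
    (hy : Metric.closedBall y r ⊆ U) : Δ (mollify F φ) y = mollify H φ y := by
  have hc : HasCompactSupport φ :=
    (isCompact_closedBall 0 r).of_isClosed_subset (isClosed_tsupport φ) hr
  have hsupp : tsupport (fun t => φ (y - t)) ⊆ U := by
    rw [show tsupport (fun t => φ (y - t)) = (Homeomorph.subLeft y) ⁻¹' tsupport φ from
      tsupport_comp_eq_preimage φ (Homeomorph.subLeft y)]
    exact fun t ht => hy (by simpa [dist_eq_norm, norm_sub_rev] using hr ht)
  rw [laplacian_mollify hF hφ hc]
  simp only [mollify, convolution_mul]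
  rw [← hFH (fun t => φ (y - t)) (hφ.comp (contDiff_const.sub contDiff_id))
    (hc.comp_homeomorph (Homeomorph.subLeft y)) hsupp]
  simp_rw [laplacian_comp_sub_left (contDiff_infty.1 hφ 2)]

lemma tendsto_eLpNorm_translate (hF : MemLp F 2) :
    Tendsto (fun z : EuclideanSpace ℝ (Fin d) => eLpNorm (fun y => F (z + y) - F y) 2 volume)
      (𝓝 0) (𝓝 0) := by
  have : Fact ((2 : ℝ≥0∞) ≠ ⊤) := ⟨by simp⟩
  let T : EuclideanSpace ℝ (Fin d) → Lp ℝ 2 (volume : Measure (EuclideanSpace ℝ (Fin d))) :=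
    fun z => DomAddAct.mk z +ᵥ hF.toLp F
  have hT : Continuous T := DomAddAct.continuous_mk.vadd continuous_const
  have hT₀ : T 0 = hF.toLp F := by simp [T]
  have hlim : Tendsto (fun z => edist (T z) (T 0)) (𝓝 0) (𝓝 0) := by
    simpa using (hT.edist (continuous_const (y := T 0))).tendsto 0
  refine hlim.congr fun z => ?_
  simp only [T] at hT₀ ⊢
  rw [hT₀, DomAddAct.mk_vadd_toLp, Lp.edist_toLp_toLp]
  rfl

lemma sq_lintegral_mul_le {X : Type*} [MeasurableSpace X] {μ : Measure X} {a b : X → ℝ≥0∞}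
    (ha : AEMeasurable a μ) (hb : AEMeasurable b μ) :
    (∫⁻ x, a x * b x ∂μ) ^ 2 ≤ (∫⁻ x, a x ∂μ) * ∫⁻ x, a x * b x ^ 2 ∂μ := by
  have hsqrt_mul : ∀ x, a x ^ (1 / 2 : ℝ) * a x ^ (1 / 2 : ℝ) = a x := fun x => by
    rw [← ENNReal.rpow_add_of_nonneg _ _ (by norm_num) (by norm_num)]
    norm_num
  have hsqrt_sq : ∀ x : ℝ≥0∞, (x ^ (1 / 2 : ℝ)) ^ 2 = x := fun x => by
    rw [← ENNReal.rpow_natCast, ← ENNReal.rpow_mul]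
    norm_num
  have hholder := ENNReal.lintegral_mul_le_Lp_mul_Lq μ Real.HolderConjugate.two_two
    (ha.pow_const (1 / 2 : ℝ)) ((ha.pow_const (1 / 2 : ℝ)).mul hb)
  simp only [Pi.mul_apply, ← mul_assoc, hsqrt_mul, ENNReal.rpow_two, mul_pow, hsqrt_sq]
    at hholder
  simpa only [mul_pow, hsqrt_sq] using pow_le_pow_left' hholder 2

lemma eLpNorm_two_sq {X E : Type*} [MeasurableSpace X] [NormedAddCommGroup E] (f : X → E)
    (μ : Measure X) : eLpNorm f 2 μ ^ 2 = ∫⁻ x, ‖f x‖ₑ ^ 2 ∂μ := by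
  simpa using eLpNorm_nnreal_pow_eq_lintegral (f := f) (μ := μ) (p := 2) (by norm_num)

lemma lintegral_enorm_normed (b : ContDiffBump (0 : EuclideanSpace ℝ (Fin d))) :
    ∫⁻ t, ‖b.normed volume t‖ₑ = 1 := by
  have hnorm : ∀ t, ‖b.normed volume t‖ = b.normed volume t := fun t =>
    Real.norm_of_nonneg (b.nonneg_normed t)
  rw [← ofReal_integral_norm_eq_lintegral_enorm b.integrable_normed]
  simp_rw [hnorm, b.integral_normed, ENNReal.ofReal_one]

lemma enorm_mollify_sub_sq_le (hF : LocallyIntegrable F)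
    (b : ContDiffBump (0 : EuclideanSpace ℝ (Fin d))) (y : EuclideanSpace ℝ (Fin d)) :
    ‖mollify F (b.normed volume) y - F y‖ₑ ^ 2
      ≤ ∫⁻ t, ‖b.normed volume t‖ₑ * ‖F (y - t) - F y‖ₑ ^ 2 := by
  set φ := b.normed (volume : Measure (EuclideanSpace ℝ (Fin d)))
  have hmeas : AEStronglyMeasurable fun t => F (y - t) - F y :=
    (hF.aestronglyMeasurable.comp_quasiMeasurePreserving
      (quasiMeasurePreserving_sub_left_of_right_invariant volume y)).sub
        aestronglyMeasurable_const
  have hint : Integrable fun t => F (y - t) * φ t := by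
    simpa [mul_comm, φ, ConvolutionExistsAt] using
      b.hasCompactSupport_normed.convolutionExists_left
        (ContinuousLinearMap.mul ℝ ℝ) b.continuous_normed hF y (μ := volume)
  have hmean : mollify F φ y - F y = ∫ t, φ t * (F (y - t) - F y) := by
    have hconst : F y = ∫ t, F y * φ t := by rw [integral_const_mul, b.integral_normed, mul_one]
    rw [mollify, convolution_mul_swap]
    conv_lhs => rw [hconst]
    rw [← integral_sub hint (b.integrable_normed.const_mul _)]
    congr with t
    ring
  have hle : ‖mollify F φ y - F y‖ₑ ≤ ∫⁻ t, ‖φ t‖ₑ * ‖F (y - t) - F y‖ₑ := by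
    rw [hmean]
    refine (enorm_integral_le_lintegral_enorm _).trans_eq ?_
    simp_rw [enorm_mul]
  calc ‖mollify F φ y - F y‖ₑ ^ 2 ≤ (∫⁻ t, ‖φ t‖ₑ * ‖F (y - t) - F y‖ₑ) ^ 2 :=
        pow_le_pow_left' hle 2
    _ ≤ (∫⁻ t, ‖φ t‖ₑ) * ∫⁻ t, ‖φ t‖ₑ * ‖F (y - t) - F y‖ₑ ^ 2 :=
        sq_lintegral_mul_le b.continuous_normed.enorm.measurable.aemeasurable hmeas.enorm
    _ = ∫⁻ t, ‖φ t‖ₑ * ‖F (y - t) - F y‖ₑ ^ 2 := by rw [lintegral_enorm_normed, one_mul]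

lemma eLpNorm_mollify_sub_le (hF : MemLp F 2) {ε : ℝ≥0∞}
    (b : ContDiffBump (0 : EuclideanSpace ℝ (Fin d)))
    (hb : ∀ z, ‖z‖ ≤ b.rOut → eLpNorm (fun y => F (z + y) - F y) 2 volume ≤ ε) :
    eLpNorm (fun y => mollify F (b.normed volume) y - F y) 2 volume ≤ ε := by
  set φ := b.normed (volume : Measure (EuclideanSpace ℝ (Fin d))) with hφ
  have hφm : Measurable fun t => ‖φ t‖ₑ := b.continuous_normed.enorm.measurable
  have hmeas : AEStronglyMeasurable
      (fun p : EuclideanSpace ℝ (Fin d) × EuclideanSpace ℝ (Fin d) => F (p.1 - p.2) - F p.1)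
      (volume.prod volume) :=
    (hF.1.comp_quasiMeasurePreserving
      (quasiMeasurePreserving_sub_of_right_invariant volume volume)).sub hF.1.comp_fst
  have htranslate : ∀ t, ∫⁻ y, ‖φ t‖ₑ * ‖F (y - t) - F y‖ₑ ^ 2 ≤ ‖φ t‖ₑ * ε ^ 2 := by
    intro t
    by_cases ht : ‖t‖ < b.rOut
    · rw [lintegral_const_mul' _ _ (by simp), ← eLpNorm_two_sq]
      have hε := hb (-t) (by simpa using ht.le)
      simp_rw [neg_add_eq_sub] at hε
      gcongr
    · have hzero : φ t = 0 :=
        Function.notMem_support.1 (by simpa [hφ, b.support_normed_eq] using ht)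
      simp [hzero]
  have hsq : eLpNorm (fun y => mollify F φ y - F y) 2 volume ^ 2 ≤ ε ^ 2 :=
    calc eLpNorm (fun y => mollify F φ y - F y) 2 volume ^ 2
        = ∫⁻ y, ‖mollify F φ y - F y‖ₑ ^ 2 := eLpNorm_two_sq _ _
      _ ≤ ∫⁻ y, ∫⁻ t, ‖φ t‖ₑ * ‖F (y - t) - F y‖ₑ ^ 2 :=
          lintegral_mono fun y => enorm_mollify_sub_sq_le (hF.locallyIntegrable (by norm_num)) b y
      _ = ∫⁻ t, ∫⁻ y, ‖φ t‖ₑ * ‖F (y - t) - F y‖ₑ ^ 2 :=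
          lintegral_lintegral_swap ((hφm.comp measurable_snd).aemeasurable.mul
            (hmeas.enorm.pow_const 2))
      _ ≤ ∫⁻ t, ‖φ t‖ₑ * ε ^ 2 := lintegral_mono htranslate
      _ = ε ^ 2 := by rw [lintegral_mul_const _ hφm, lintegral_enorm_normed, one_mul]
  exact (ENNReal.pow_le_pow_left_iff two_ne_zero).1 hsq

lemma memLp_mollify (hF : MemLp F 2) (b : ContDiffBump (0 : EuclideanSpace ℝ (Fin d))) :
    MemLp (mollify F (b.normed volume)) 2 := by
  have hmeas : AEStronglyMeasurable (mollify F (b.normed volume)) :=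
    (contDiff_mollify (hF.locallyIntegrable (by norm_num)) b.contDiff_normed
      b.hasCompactSupport_normed).continuous.aestronglyMeasurable
  have htranslate : ∀ z, eLpNorm (fun y => F (z + y) - F y) 2 volume
      ≤ eLpNorm F 2 volume + eLpNorm F 2 volume := fun z => by
    have hz := measurePreserving_add_left (volume : Measure (EuclideanSpace ℝ (Fin d))) z
    refine (eLpNorm_sub_le (hF.1.comp_measurePreserving hz) hF.1 (by norm_num)).trans_eq ?_
    rw [eLpNorm_comp_measurePreserving hF.1 hz]
  have hdiff : MemLp (fun y => mollify F (b.normed volume) y - F y) 2 :=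
    ⟨hmeas.sub hF.1, (eLpNorm_mollify_sub_le hF b fun z _ => htranslate z).trans_lt
      (ENNReal.add_lt_top.2 ⟨hF.2, hF.2⟩)⟩
  exact (hdiff.add hF).ae_eq (Eventually.of_forall fun y => sub_add_cancel _ _)

lemma tendsto_mollify (hF : MemLp F 2) {b : ℕ → ContDiffBump (0 : EuclideanSpace ℝ (Fin d))}
    (hb : Tendsto (fun n => (b n).rOut) atTop (𝓝 0)) :
    Tendsto (fun n => eLpNorm (fun y => mollify F ((b n).normed volume) y - F y) 2 volume)
      atTop (𝓝 0) := by
  rw [ENNReal.tendsto_nhds_zero]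
  intro ε hε
  obtain ⟨r, hr, hball⟩ := Metric.eventually_nhds_iff.1
    (ENNReal.tendsto_nhds_zero.1 (tendsto_eLpNorm_translate hF) ε hε)
  filter_upwards [hb.eventually (gt_mem_nhds hr)] with n hn
  exact eLpNorm_mollify_sub_le hF (b n) fun z hz => hball (by simpa using hz.trans_lt hn)

lemma exists_smooth_approx_of_distribLaplacian {s S : ℝ} (hs : s < S) (hF : MemLp F 2)
    (hH : MemLp H 2) (hFH : HasDistribLaplacianOn (Metric.ball 0 S) F H) :
    ∃ u h : ℕ → EuclideanSpace ℝ (Fin d) → ℝ,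
      (∀ n, ContDiff ℝ ∞ (u n)) ∧ (∀ n, MemLp (u n) 2) ∧ (∀ n, MemLp (h n) 2) ∧
        (∀ n, Set.EqOn (Δ (u n)) (h n) (Metric.closedBall 0 s)) ∧
        Tendsto (fun n => eLpNorm (fun y => u n y - F y) 2 volume) atTop (𝓝 0) ∧
        Tendsto (fun n => eLpNorm (fun y => h n y - H y) 2 volume) atTop (𝓝 0) := by
  let r : ℕ → ℝ := fun n => (S - s) / 2 / (n + 1)
  have hr : ∀ n, 0 < r n := fun n => div_pos (half_pos (sub_pos.2 hs)) n.cast_add_one_pos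
  have hr_le : ∀ n, r n ≤ (S - s) / 2 := fun n =>
    div_le_self (by linarith) (by linarith [n.cast_nonneg (α := ℝ)])
  let b : ℕ → ContDiffBump (0 : EuclideanSpace ℝ (Fin d)) := fun n =>
    ⟨r n / 2, r n, half_pos (hr n), half_lt_self (hr n)⟩
  have hb : Tendsto (fun n => (b n).rOut) atTop (𝓝 0) := by
    simpa [b, r, div_eq_mul_inv] using
      (tendsto_one_div_add_atTop_nhds_zero_nat (𝕜 := ℝ)).const_mul ((S - s) / 2)
  have hFloc := hF.locallyIntegrable (by norm_num)
  refine ⟨fun n => mollify F ((b n).normed volume), fun n => mollify H ((b n).normed volume),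
    fun n => contDiff_mollify hFloc (b n).contDiff_normed (b n).hasCompactSupport_normed,
    fun n => memLp_mollify hF (b n), fun n => memLp_mollify hH (b n), fun n y hy => ?_,
    tendsto_mollify hF hb, tendsto_mollify hH hb⟩
  refine laplacian_mollify_of_distrib hFloc hFH (b n).contDiff_normed
    (b n).tsupport_normed_eq.subset fun t ht => ?_
  rw [mem_closedBall_iff_norm] at ht
  rw [mem_closedBall_zero_iff] at hy
  rw [mem_ball_zero_iff]
  linarith [norm_le_norm_add_norm_sub' t y, hr_le n]

lemma lintegral_enorm_mul_sq_sub_le {X : Type*} [MeasurableSpace X] {μ : Measure X}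
    {c u f : X → ℝ} {K : ℝ} (hK : ∀ x, |c x| ≤ K) (hu : AEStronglyMeasurable u μ)
    (hf : AEStronglyMeasurable f μ) :
    ∫⁻ x, ‖c x * u x ^ 2 - c x * f x ^ 2‖ₑ ∂μ
      ≤ ENNReal.ofReal K * (eLpNorm (fun x => u x - f x) 2 μ
        * (eLpNorm (fun x => u x - f x) 2 μ + 2 * eLpNorm f 2 μ)) := by
  have hsub : AEStronglyMeasurable (fun x => u x - f x) μ := hu.sub hf
  have hadd : AEStronglyMeasurable (fun x => u x + f x) μ := hu.add hf
  have hpoint : ∀ x, ‖c x * u x ^ 2 - c x * f x ^ 2‖ₑ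
      ≤ ENNReal.ofReal K * (‖u x - f x‖ₑ * ‖u x + f x‖ₑ) := fun x => by
    rw [show c x * u x ^ 2 - c x * f x ^ 2 = c x * ((u x - f x) * (u x + f x)) by ring,
      enorm_mul, enorm_mul, ← ofReal_norm (c x)]
    gcongr
    exact hK x
  have hcauchySchwarz : ∫⁻ x, ‖u x - f x‖ₑ * ‖u x + f x‖ₑ ∂μ
      ≤ eLpNorm (fun x => u x - f x) 2 μ * eLpNorm (fun x => u x + f x) 2 μ := by
    simpa [enorm_mul, eLpNorm_one_eq_lintegral_enorm] using
      eLpNorm_smul_le_mul_eLpNorm (p := 2) (q := 2) (r := 1) hadd hsub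
  have htriangle : eLpNorm (fun x => u x + f x) 2 μ
      ≤ eLpNorm (fun x => u x - f x) 2 μ + 2 * eLpNorm f 2 μ := by
    rw [show (fun x => u x + f x) = (fun x => u x - f x) + (f + f) by
      funext x; simp only [Pi.add_apply]; ring, two_mul]
    exact (eLpNorm_add_le hsub (hf.add hf) (by norm_num)).trans
      (add_le_add_right (eLpNorm_add_le hf hf (by norm_num)) _)
  calc ∫⁻ x, ‖c x * u x ^ 2 - c x * f x ^ 2‖ₑ ∂μ
      ≤ ENNReal.ofReal K * ∫⁻ x, ‖u x - f x‖ₑ * ‖u x + f x‖ₑ ∂μ :=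
        (lintegral_mono hpoint).trans_eq (lintegral_const_mul' _ _ (by simp))
    _ ≤ _ := by gcongr; exact hcauchySchwarz.trans (by gcongr)

lemma tendsto_setIntegral_mul_sq {X : Type*} [MeasurableSpace X] {μ : Measure X}
    {c f : X → ℝ} {K : ℝ} {u : ℕ → X → ℝ} (hc : AEStronglyMeasurable c μ)
    (hK : ∀ x, |c x| ≤ K) (hu : ∀ n, MemLp (u n) 2 μ) (hf : MemLp f 2 μ)
    (hlim : Tendsto (fun n => eLpNorm (fun x => u n x - f x) 2 μ) atTop (𝓝 0)) (s : Set X) :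
    Tendsto (fun n => ∫ x in s, c x * u n x ^ 2 ∂μ) atTop (𝓝 (∫ x in s, c x * f x ^ 2 ∂μ)) := by
  have hint : ∀ {v : X → ℝ}, MemLp v 2 μ → Integrable (fun x => c x * v x ^ 2) μ := fun hv =>
    hv.integrable_sq.bdd_mul hc (Eventually.of_forall hK)
  refine tendsto_setIntegral_of_L1 _ (hint hf).1 (Eventually.of_forall fun n => hint (hu n))
    (tendsto_of_tendsto_of_tendsto_of_le_of_le tendsto_const_nhds ?_ (fun _ => zero_le)
      fun n => lintegral_enorm_mul_sq_sub_le hK (hu n).1 hf.1) s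
  have htop : 2 * eLpNorm f 2 μ ≠ ⊤ := ENNReal.mul_ne_top (by simp) hf.2.ne
  have hprod := ENNReal.Tendsto.mul hlim (Or.inr (by simpa using htop))
    (hlim.add_const (2 * eLpNorm f 2 μ)) (Or.inr (by simp))
  simpa using ENNReal.Tendsto.const_mul (a := ENNReal.ofReal K) hprod (Or.inr (by simp))

end Mollify

section DifferentialInequality

variable {d : ℕ} {F H c : EuclideanSpace ℝ (Fin d) → ℝ} {α ρ l l₁ l₂ R KV : ℝ}

lemma IsPuncturedTest.exists_bound (hc : IsPuncturedTest c) : ∃ K, ∀ y, |c y| ≤ K :=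
  hc.hasCompactSupport.exists_bound_of_continuous hc.contDiff.continuous

lemma IsPuncturedTest.integrable_mul_sq (hc : IsPuncturedTest c) (hF : MemLp F 2) :
    Integrable fun y => c y * F y ^ 2 := by
  obtain ⟨K, hK⟩ := hc.exists_bound
  exact hF.integrable_sq.bdd_mul hc.contDiff.continuous.aestronglyMeasurable
    (Eventually.of_forall hK)

lemma IsPuncturedTest.tendsto_integral_mul_sq (hc : IsPuncturedTest c)
    {u : ℕ → EuclideanSpace ℝ (Fin d) → ℝ} (hu : ∀ n, MemLp (u n) 2) (hF : MemLp F 2)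
    (hlim : Tendsto (fun n => eLpNorm (fun y => u n y - F y) 2 volume) atTop (𝓝 0)) :
    Tendsto (fun n => ∫ y, c y * u n y ^ 2) atTop (𝓝 (∫ y, c y * F y ^ 2)) := by
  obtain ⟨K, hK⟩ := hc.exists_bound
  simpa only [setIntegral_univ] using tendsto_setIntegral_mul_sq
    hc.contDiff.continuous.aestronglyMeasurable hK hu hF hlim Set.univ

lemma cutoffError_eq (C α ρ l : ℝ) (hF : MemLp F 2) (hH : MemLp H 2) :
    cutoffError C α ρ l F H = C * carlemanWeight α ρ l / l ^ 2 *
      ((∫ y in Metric.closedBall 0 (121 / 100 * l), F y ^ 2)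
        + l ^ 4 * ∫ y in Metric.closedBall 0 (121 / 100 * l), H y ^ 2) := by
  rw [cutoffError, integral_add hF.integrable_sq.integrableOn
    (hH.integrable_sq.const_mul _).integrableOn, integral_const_mul]

lemma cutoffError_congr (C α ρ l : ℝ) {h : EuclideanSpace ℝ (Fin d) → ℝ}
    (hHh : Set.EqOn H h (Metric.closedBall 0 (121 / 100 * l))) :
    cutoffError C α ρ l F H = cutoffError C α ρ l F h := by
  rw [cutoffError, cutoffError,
    setIntegral_congr_fun Metric.isClosed_closedBall.measurableSet fun y hy => by rw [hHh hy]]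

lemma tendsto_cutoffError (C α ρ l : ℝ) {u h : ℕ → EuclideanSpace ℝ (Fin d) → ℝ}
    (hu : ∀ n, MemLp (u n) 2) (hF : MemLp F 2) (hh : ∀ n, MemLp (h n) 2) (hH : MemLp H 2)
    (hulim : Tendsto (fun n => eLpNorm (fun y => u n y - F y) 2 volume) atTop (𝓝 0))
    (hhlim : Tendsto (fun n => eLpNorm (fun y => h n y - H y) 2 volume) atTop (𝓝 0)) :
    Tendsto (fun n => cutoffError C α ρ l (u n) (h n)) atTop
      (𝓝 (cutoffError C α ρ l F H)) := by
  simp_rw [fun n => cutoffError_eq C α ρ l (hu n) (hh n), cutoffError_eq C α ρ l hF hH]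
  have hball : ∀ {v : ℕ → EuclideanSpace ℝ (Fin d) → ℝ} {f}, (∀ n, MemLp (v n) 2) →
      MemLp f 2 → Tendsto (fun n => eLpNorm (fun y => v n y - f y) 2 volume) atTop (𝓝 0) →
      Tendsto (fun n => ∫ y in Metric.closedBall 0 (121 / 100 * l), v n y ^ 2) atTop
        (𝓝 (∫ y in Metric.closedBall 0 (121 / 100 * l), f y ^ 2)) := fun hv hf hlim => by
    simpa only [one_mul] using tendsto_setIntegral_mul_sq (c := fun _ => 1) (K := 1)
      aestronglyMeasurable_const (fun _ => by simp) hv hf hlim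
        (Metric.closedBall 0 (121 / 100 * l))
  exact ((hball hu hF hulim).add ((hball hh hH hhlim).const_mul _)).const_mul _

theorem carleman_estimate_of_distribLaplacian (d : ℕ) : ∃ C : ℝ, 0 ≤ C ∧
    ∀ α ρ l₁ l₂ S : ℝ, 0 ≤ α → 0 < l₁ → l₁ ≤ l₂ → 11 / 10 * l₂ ≤ ρ / 2 → 121 / 100 * l₂ < S →
    ∀ F H : EuclideanSpace ℝ (Fin d) → ℝ, MemLp F 2 → MemLp H 2 →
      HasDistribLaplacianOn (Metric.ball 0 S) F H →
      (α ^ 3 - α) / ρ *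
          ∫ y, carlemanWeight α ρ ‖y‖ * ‖y‖⁻¹ * annulusCutoff l₁ l₂ y ^ 2 * F y ^ 2
        ≤ 2 * (∫ y, carlemanWeight α ρ ‖y‖ * ‖y‖ ^ 2 * annulusCutoff l₁ l₂ y ^ 2 * H y ^ 2)
          + cutoffError C α ρ l₁ F H + cutoffError C α ρ l₂ F H := by
  obtain ⟨C, hC, hsmooth⟩ := carleman_estimate_annulusCutoff d
  refine ⟨C, hC, fun α ρ l₁ l₂ S hα h₁ h₁₂ hl₂ hS F H hF hH hFH => ?_⟩
  obtain ⟨u, h, hu, huL, hhL, hΔ, hulim, hhlim⟩ :=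
    exists_smooth_approx_of_distribLaplacian hS hF hH hFH
  have hη := (isPuncturedTest_annulusCutoff (d := d) h₁ h₁₂).pow_two
  have hcongr : ∀ n y, carlemanWeight α ρ ‖y‖ * ‖y‖ ^ 2 * annulusCutoff l₁ l₂ y ^ 2 * Δ (u n) y ^ 2
      = carlemanWeight α ρ ‖y‖ * ‖y‖ ^ 2 * annulusCutoff l₁ l₂ y ^ 2 * h n y ^ 2 := fun n y => by
    by_cases hy : ‖y‖ ≤ 121 / 100 * l₂
    · rw [hΔ n (mem_closedBall_zero_iff.2 hy)]
    · rw [annulusCutoff_eq_zero h₁ h₁₂ (Or.inr (by linarith))]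
      simp
  have happrox := fun n => hsmooth α ρ l₁ l₂ hα h₁ h₁₂ hl₂ (u n) (hu n)
  simp_rw [hcongr, fun n => cutoffError_congr (F := u n) C α ρ l₂ (hΔ n),
    fun n => cutoffError_congr (F := u n) C α ρ l₁ ((hΔ n).mono (Metric.closedBall_subset_closedBall
      (mul_le_mul_of_nonneg_left h₁₂ (by norm_num))))] at happrox
  exact le_of_tendsto_of_tendsto'
    ((hη.mul_left.tendsto_integral_mul_sq huL hF hulim).const_mul _)
    ((((hη.mul_left.tendsto_integral_mul_sq hhL hH hhlim).const_mul 2).add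
      (tendsto_cutoffError C α ρ l₁ huL hF hhL hH hulim hhlim)).add
      (tendsto_cutoffError C α ρ l₂ huL hF hhL hH hulim hhlim)) happrox

lemma cutoffError_le {C : ℝ} (hC : 0 ≤ C) (α ρ l : ℝ) (hF : MemLp F 2) (hH : MemLp H 2)
    (hHF : ∀ᵐ y, H y ^ 2 ≤ KV ^ 2 * F y ^ 2) :
    cutoffError C α ρ l F H ≤ (1 + KV ^ 2 * l ^ 4) * (C * carlemanWeight α ρ l / l ^ 2 *
      ∫ y in Metric.closedBall 0 (121 / 100 * l), F y ^ 2) := by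
  have hball : ∫ y in Metric.closedBall 0 (121 / 100 * l), H y ^ 2
      ≤ KV ^ 2 * ∫ y in Metric.closedBall 0 (121 / 100 * l), F y ^ 2 := by
    rw [← integral_const_mul]
    exact setIntegral_mono_ae hH.integrable_sq.integrableOn
      (hF.integrable_sq.const_mul _).integrableOn hHF
  have hw := carlemanWeight_pos α ρ l
  rw [cutoffError_eq C α ρ l hF hH]
  calc _ ≤ C * carlemanWeight α ρ l / l ^ 2 *
        ((∫ y in Metric.closedBall 0 (121 / 100 * l), F y ^ 2)
          + l ^ 4 * (KV ^ 2 * ∫ y in Metric.closedBall 0 (121 / 100 * l), F y ^ 2)) := by gcongr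
    _ = _ := by ring

lemma two_mul_integral_carlemanWeight_mul_sq_le (hl₁ : 0 < l₁) (hl₁₂ : l₁ ≤ l₂) (hR : 0 < R)
    (hl₂R : 11 / 10 * l₂ ≤ 12 * R) (hα : 24 ^ 5 * KV ^ 2 * R ^ 4 ≤ α ^ 3) (hF : MemLp F 2)
    (hH : MemLp H 2) (hHF : ∀ᵐ y, H y ^ 2 ≤ KV ^ 2 * F y ^ 2) :
    2 * (∫ y, carlemanWeight α ρ ‖y‖ * ‖y‖ ^ 2 * annulusCutoff l₁ l₂ y ^ 2 * H y ^ 2)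
      ≤ α ^ 3 / (96 * R) *
        ∫ y, carlemanWeight α ρ ‖y‖ * ‖y‖⁻¹ * annulusCutoff l₁ l₂ y ^ 2 * F y ^ 2 := by
  have hη := isPuncturedTest_annulusCutoff (d := d) hl₁ hl₁₂
  have hcoeff : 2 * (12 * R) ^ 3 * KV ^ 2 ≤ α ^ 3 / (96 * R) := by
    rw [le_div_iff₀ (by positivity)]
    nlinarith [show 0 ≤ KV ^ 2 * R ^ 4 by positivity]
  rw [← integral_const_mul, ← integral_const_mul]
  refine integral_mono_ae ((hη.pow_two.mul_left.integrable_mul_sq hH).const_mul _)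
    ((hη.pow_two.mul_left.integrable_mul_sq hF).const_mul _) ?_
  filter_upwards [hHF] with y hy
  rcases le_or_gt (11 / 10 * l₂) ‖y‖ with hfar | hnear
  · simp [annulusCutoff_eq_zero hl₁ hl₁₂ (Or.inr hfar)]
  rcases eq_or_ne y 0 with rfl | hy₀
  · simp [hη.apply_zero]
  have hy_norm := norm_ne_zero_iff.2 hy₀
  have hw := carlemanWeight_pos α ρ ‖y‖
  have hcube : ‖y‖ ^ 3 ≤ (12 * R) ^ 3 := by gcongr; linarith
  calc 2 * (carlemanWeight α ρ ‖y‖ * ‖y‖ ^ 2 * annulusCutoff l₁ l₂ y ^ 2 * H y ^ 2)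
      = 2 * ‖y‖ ^ 3 * H y ^ 2 *
          (carlemanWeight α ρ ‖y‖ * ‖y‖⁻¹ * annulusCutoff l₁ l₂ y ^ 2) := by field_simp [hy_norm]
    _ ≤ 2 * (12 * R) ^ 3 * (KV ^ 2 * F y ^ 2) *
          (carlemanWeight α ρ ‖y‖ * ‖y‖⁻¹ * annulusCutoff l₁ l₂ y ^ 2) := by gcongr
    _ = 2 * (12 * R) ^ 3 * KV ^ 2 *
          (carlemanWeight α ρ ‖y‖ * ‖y‖⁻¹ * annulusCutoff l₁ l₂ y ^ 2 * F y ^ 2) := by ring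
    _ ≤ _ := by gcongr

lemma measurableSet_shell (r s : ℝ) :
    MeasurableSet {y : EuclideanSpace ℝ (Fin d) | r ≤ ‖y‖ ∧ ‖y‖ ≤ s} :=
  (measurableSet_le measurable_const measurable_norm).inter
    (measurableSet_le measurable_norm measurable_const)

lemma carlemanWeight_mul_setIntegral_shell_le {r s : ℝ} (hα : 0 ≤ α) (hl₁ : 0 < l₁)
    (hr : 11 / 10 * l₁ ≤ r) (hl₁₂ : l₁ ≤ l₂) (hs : s ≤ l₂) (hρ : s ≤ ρ) (hF : MemLp F 2) :
    carlemanWeight α ρ s / s * ∫ y in {y | r ≤ ‖y‖ ∧ ‖y‖ ≤ s}, F y ^ 2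
      ≤ ∫ y, carlemanWeight α ρ ‖y‖ * ‖y‖⁻¹ * annulusCutoff l₁ l₂ y ^ 2 * F y ^ 2 := by
  have hη := (isPuncturedTest_annulusCutoff (d := d) hl₁ hl₁₂).pow_two
  have hint := (hη.mul_left (q := fun y => carlemanWeight α ρ ‖y‖ * ‖y‖⁻¹)).integrable_mul_sq hF
  rw [← integral_const_mul]
  refine (setIntegral_mono_on (hF.integrable_sq.const_mul _).integrableOn hint.integrableOn
    (measurableSet_shell r s) fun y hy => ?_).trans
    (setIntegral_le_integral hint (Eventually.of_forall fun y => ?_))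
  · have hy₀ : 0 < ‖y‖ := by linarith [hy.1]
    have hw := carlemanWeight_anti hα hy₀ hy.2 hρ
    have hw₀ := carlemanWeight_pos α ρ ‖y‖
    rw [annulusCutoff_eq_one hl₁ hl₁₂ (hr.trans hy.1) (hy.2.trans hs), one_pow, mul_one,
      ← div_eq_mul_inv]
    gcongr
    exact hy.2
  · have hw := carlemanWeight_pos α ρ ‖y‖
    positivity

theorem carleman_differential_inequality (d : ℕ) : ∃ C : ℝ, 0 ≤ C ∧
    ∀ (F H : EuclideanSpace ℝ (Fin d) → ℝ) (KV R l α : ℝ), 0 < R → 0 < l → 11 / 10 * l ≤ R →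
      2 ≤ α → 24 ^ 5 * KV ^ 2 * R ^ 4 ≤ α ^ 3 → MemLp F 2 → MemLp H 2 →
      (∀ᵐ y, H y ^ 2 ≤ KV ^ 2 * F y ^ 2) →
      HasDistribLaplacianOn (Metric.ball 0 (12 * R)) F H →
      α ^ 3 * carlemanWeight α (24 * R) (2 * R) / (96 * R ^ 2)
          * ∫ y in {y | R ≤ ‖y‖ ∧ ‖y‖ ≤ 2 * R}, F y ^ 2
        ≤ (1 + KV ^ 2 * l ^ 4) * (C * carlemanWeight α (24 * R) l / l ^ 2
            * ∫ y in Metric.closedBall 0 (121 / 100 * l), F y ^ 2)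
          + (1 + KV ^ 2 * (9 * R) ^ 4) * (C * carlemanWeight α (24 * R) (9 * R) / (9 * R) ^ 2
            * ∫ y in Metric.closedBall 0 (121 / 100 * (9 * R)), F y ^ 2) := by
  obtain ⟨C, hC, hcarleman⟩ := carleman_estimate_of_distribLaplacian d
  refine ⟨C, hC, fun F H KV R l α hR hl hlR hα hαV hF hH hHF hFH => ?_⟩
  have hα₀ : 0 ≤ α := by linarith
  have hl₁₂ : l ≤ 9 * R := by linarith
  have hestimate := hcarleman α (24 * R) l (9 * R) (12 * R) hα₀ hl hl₁₂ (by linarith)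
    (by linarith) F H hF hH hFH
  have hpotential := two_mul_integral_carlemanWeight_mul_sq_le (ρ := 24 * R) hl hl₁₂ hR
    (by linarith) hαV hF hH hHF
  have herr₁ := cutoffError_le hC α (24 * R) l hF hH hHF
  have herr₂ := cutoffError_le hC α (24 * R) (9 * R) hF hH hHF
  have hshell := carlemanWeight_mul_setIntegral_shell_le (r := R) (s := 2 * R) (ρ := 24 * R) hα₀
    hl hlR hl₁₂ (by linarith) (by linarith) hF
  set I := ∫ y, carlemanWeight α (24 * R) ‖y‖ * ‖y‖⁻¹ * annulusCutoff l (9 * R) y ^ 2 * F y ^ 2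
  have hI : 0 ≤ I := integral_nonneg fun y => by
    have hw := carlemanWeight_pos α (24 * R) ‖y‖
    positivity
  have hcube : 3 / 4 * α ^ 3 ≤ α ^ 3 - α := by nlinarith [sq_nonneg (α - 2)]
  calc _ = α ^ 3 / (48 * R) * (carlemanWeight α (24 * R) (2 * R) / (2 * R)
          * ∫ y in {y | R ≤ ‖y‖ ∧ ‖y‖ ≤ 2 * R}, F y ^ 2) := by ring
    _ ≤ α ^ 3 / (48 * R) * I := by gcongr
    _ = 3 / 4 * α ^ 3 / (24 * R) * I - α ^ 3 / (96 * R) * I := by ring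
    _ ≤ (α ^ 3 - α) / (24 * R) * I - α ^ 3 / (96 * R) * I := by gcongr
    _ ≤ _ := by linarith

end DifferentialInequality

section WeakDerivatives

variable {d : ℕ} {G U : Set (EuclideanSpace ℝ (Fin d))} {i : Fin d}
  {F H u u' v v' χ ψ : EuclideanSpace ℝ (Fin d) → ℝ}

lemma integrable_mul_test (hv : LocallyIntegrableOn v G) (hχ : Continuous χ)
    (hc : HasCompactSupport χ) (hs : tsupport χ ⊆ G) : Integrable fun y => v y * χ y := by
  have hK : IntegrableOn (fun y => v y * χ y) (tsupport χ) :=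
    (hv.integrableOn_compact_subset hs hc).mul_continuousOn hχ.continuousOn hc
  refine (integrableOn_iff_integrable_of_support_subset fun y hy => ?_).1 hK
  exact subset_tsupport χ (right_ne_zero_of_mul hy)

lemma setIntegral_mul_test (v : EuclideanSpace ℝ (Fin d) → ℝ) (hs : tsupport χ ⊆ G) :
    ∫ y in G, v y * χ y = ∫ y, v y * χ y :=
  setIntegral_eq_integral_of_forall_compl_eq_zero fun y hy => by
    rw [image_eq_zero_of_notMem_tsupport fun h => hy (hs h), mul_zero]

lemma IsWeakPartial.ae_eq (hG : IsOpen G) (h : IsWeakPartial G i u v)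
    (h' : IsWeakPartial G i u v') : v =ᵐ[volume.restrict G] v' := by
  have hzero := hG.ae_eq_zero_of_integral_contDiff_smul_eq_zero (h.2.1.sub h'.2.1)
    fun φ hφ hc hs => by
      have hvv' : ∫ y, v y * φ y = ∫ y, v' y * φ y := by
        rw [← setIntegral_mul_test v hs, ← setIntegral_mul_test v' hs, ← neg_inj,
          ← h.2.2 φ hφ hc hs, h'.2.2 φ hφ hc hs]
      simp_rw [Pi.sub_apply, smul_eq_mul, mul_comm (φ _), sub_mul]
      rw [integral_sub (integrable_mul_test h.2.1 hφ.continuous hc hs)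
        (integrable_mul_test h'.2.1 hφ.continuous hc hs), hvv', sub_self]
  rw [EventuallyEq, ae_restrict_iff' hG.measurableSet]
  filter_upwards [hzero] with y hy hyG using sub_eq_zero.1 (hy hyG)

lemma IsWeakPartial.congr (h : IsWeakPartial G i u v) (huu' : u =ᵐ[volume.restrict G] u') :
    IsWeakPartial G i u' v := by
  refine ⟨h.1.congr huu', h.2.1, fun φ hφ hc hs => ?_⟩
  rw [← h.2.2 φ hφ hc hs]
  refine integral_congr_ae ?_
  filter_upwards [huu'] with y hy
  rw [hy]

lemma isWeakPartial_weakPartial_of_exists (h : ∃ v, IsWeakPartial G i u v) :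
    IsWeakPartial G i u (weakPartial G i u) := by
  rw [weakPartial, dif_pos h]
  exact h.choose_spec

lemma MemSobolevTwo.isWeakPartial_weakPartial (hG : IsOpen G) (hψ : MemSobolevTwo G 2 ψ)
    (i : Fin d) : IsWeakPartial G i ψ (weakPartial G i ψ) ∧
      IsWeakPartial G i (weakPartial G i ψ) (weakPartial G i (weakPartial G i ψ)) := by
  obtain ⟨v, hv, hv_mem⟩ := hψ.2 i
  obtain ⟨w, hw, -⟩ := hv_mem.2 i
  have hfirst := isWeakPartial_weakPartial_of_exists ⟨v, hv⟩
  exact ⟨hfirst, isWeakPartial_weakPartial_of_exists ⟨w, hw.congr (hv.ae_eq hG hfirst)⟩⟩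

lemma aestronglyMeasurable_weakLaplacian (hG : IsOpen G) (hψ : MemSobolevTwo G 2 ψ) :
    AEStronglyMeasurable (weakLaplacian G ψ) (volume.restrict G) := by
  unfold weakLaplacian
  exact Finset.aestronglyMeasurable_fun_sum _ fun i _ =>
    (hψ.isWeakPartial_weakPartial hG i).2.2.1.aestronglyMeasurable

lemma hasDistribLaplacianOn_weakLaplacian (hG : IsOpen G) (hψ : MemSobolevTwo G 2 ψ) :
    HasDistribLaplacianOn G ψ (weakLaplacian G ψ) := by
  intro χ hχ hc hs
  have hweak := hψ.isWeakPartial_weakPartial hG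
  have hχ₁ : ∀ i, ContDiff ℝ ∞ (partialDeriv i χ) := fun i => contDiff_partialDeriv i hχ le_rfl
  have hc₁ := fun i => hasCompactSupport_partialDeriv i hc
  have hs₁ : ∀ i, tsupport (partialDeriv i χ) ⊆ G := fun i =>
    (tsupport_fderiv_apply_subset ℝ _).trans hs
  have hs₂ : ∀ i, tsupport (partialDeriv i (partialDeriv i χ)) ⊆ G := fun i =>
    (tsupport_fderiv_apply_subset ℝ _).trans (hs₁ i)
  have hχΔ : ∀ y, Δ χ y = ∑ i, partialDeriv i (partialDeriv i χ) y := fun _ =>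
    laplacian_eq_sum_partialDeriv (contDiff_infty.1 hχ 2).contDiffAt
  simp only [hχΔ, weakLaplacian, Finset.mul_sum, Finset.sum_mul]
  rw [integral_finsetSum _ fun i _ => integrable_mul_test (hweak i).1.1
      (contDiff_partialDeriv (m := 0) i (hχ₁ i) (by simp)).continuous
      (hasCompactSupport_partialDeriv i (hc₁ i)) (hs₂ i),
    integral_finsetSum _ fun i _ => integrable_mul_test (hweak i).2.2.1 hχ.continuous hc hs]
  refine Finset.sum_congr rfl fun i _ => ?_
  calc ∫ y, ψ y * partialDeriv i (partialDeriv i χ) y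
      = ∫ y in G, ψ y * partialDeriv i (partialDeriv i χ) y :=
        (setIntegral_mul_test ψ (hs₂ i)).symm
    _ = -∫ y in G, weakPartial G i ψ y * partialDeriv i χ y :=
        (hweak i).1.2.2 _ (hχ₁ i) (hc₁ i) (hs₁ i)
    _ = ∫ y in G, weakPartial G i (weakPartial G i ψ) y * χ y :=
        neg_eq_iff_eq_neg.2 ((hweak i).2.2.2 χ hχ hc hs)
    _ = ∫ y, weakPartial G i (weakPartial G i ψ) y * χ y := setIntegral_mul_test _ hs

lemma HasDistribLaplacianOn.mono (hFH : HasDistribLaplacianOn G F H) (hUG : U ⊆ G) :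
    HasDistribLaplacianOn U F H :=
  fun χ hχ hc hs => hFH χ hχ hc (hs.trans hUG)

lemma HasDistribLaplacianOn.indicator (hFH : HasDistribLaplacianOn U F H) :
    HasDistribLaplacianOn U (U.indicator F) (U.indicator H) := by
  intro χ hχ hc hs
  have hout : ∀ y ∉ U, χ y = 0 ∧ Δ χ y = 0 := fun y hy => by
    have hyχ := notMem_tsupport_iff_eventuallyEq.1 fun h => hy (hs h)
    exact ⟨hyχ.self_of_nhds, (laplacian_eventuallyEq_zero hyχ).self_of_nhds⟩
  convert hFH χ hχ hc hs using 3 with y y <;> by_cases hy : y ∈ U <;> simp [hy, hout]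

lemma HasDistribLaplacianOn.comp_add_left (hFH : HasDistribLaplacianOn U F H)
    (a : EuclideanSpace ℝ (Fin d)) :
    HasDistribLaplacianOn ((a + ·) ⁻¹' U) (fun y => F (a + y)) (fun y => H (a + y)) := by
  intro χ hχ hc hs
  have hs' : tsupport (fun z => χ (z - a)) ⊆ U := by
    have htranslate : tsupport (fun z => χ (z - a)) = (Homeomorph.subRight a) ⁻¹' tsupport χ :=
      tsupport_comp_eq_preimage χ (Homeomorph.subRight a)
    rw [htranslate]
    intro z hz
    simpa using hs hz
  have htest := hFH (fun z => χ (z - a)) (hχ.comp (contDiff_id.sub contDiff_const))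
    (hc.comp_homeomorph (Homeomorph.subRight a)) hs'
  simp only [laplacian_comp_sub_right] at htest
  rw [← integral_add_left_eq_self _ a, ← integral_add_left_eq_self (fun z => H z * _) a] at htest
  simpa only [add_sub_cancel_left] using htest

end WeakDerivatives

section Localization

variable {d : ℕ} {G U s t Θ : Set (EuclideanSpace ℝ (Fin d))} {f ψ : EuclideanSpace ℝ (Fin d) → ℝ}
  {x : EuclideanSpace ℝ (Fin d)} {KV R : ℝ}

lemma memLp_indicator_comp_add_left (hf : MemLp f 2 (volume.restrict G)) (hU : MeasurableSet U)
    (hUG : U ⊆ G) (a : EuclideanSpace ℝ (Fin d)) : MemLp (fun y => U.indicator f (a + y)) 2 :=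
  ((memLp_indicator_iff_restrict hU).2
    (hf.mono_measure (Measure.restrict_mono hUG le_rfl))).comp_measurePreserving
      (measurePreserving_add_left volume a)

lemma sqNorm_indicator_comp_add_left (f : EuclideanSpace ℝ (Fin d) → ℝ) (hs : MeasurableSet s)
    (hsU : s ⊆ U) (a : EuclideanSpace ℝ (Fin d)) :
    sqNorm ((a + ·) ⁻¹' s) (fun y => U.indicator f (a + y)) = sqNorm s f := by
  unfold sqNorm
  rw [(measurePreserving_add_left volume a).setIntegral_preimage_emb
    (MeasurableEquiv.addLeft a).measurableEmbedding (fun z => U.indicator f z ^ 2)]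
  exact setIntegral_congr_fun hs fun y hy => by simp only [Set.indicator_of_mem (hsU hy)]

lemma sqNorm_nonneg (s : Set (EuclideanSpace ℝ (Fin d))) (f : EuclideanSpace ℝ (Fin d) → ℝ) :
    0 ≤ sqNorm s f :=
  integral_nonneg fun y => sq_nonneg (f y)

lemma sqNorm_mono (hf : MemLp f 2 (volume.restrict G)) (hst : s ⊆ t) (htG : t ⊆ G) :
    sqNorm s f ≤ sqNorm t f :=
  setIntegral_mono_set (IntegrableOn.mono_set hf.integrable_sq htG)
    (Eventually.of_forall fun y => sq_nonneg (f y)) hst.eventuallyLE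

lemma subset_shell_of_infEDist_eq (hR : 0 < R) (hdiam : Metric.ediam Θ ≤ ENNReal.ofReal R)
    (hdist : Metric.infEDist x Θ = ENNReal.ofReal R) :
    Θ ⊆ {y | R ≤ dist y x ∧ dist y x ≤ 2 * R} := by
  refine fun y hy => ⟨?_, le_of_forall_pos_lt_add fun ε hε => ?_⟩
  · have hxy : ENNReal.ofReal R ≤ edist x y := hdist ▸ Metric.infEDist_le_edist_of_mem hy
    rwa [edist_dist, ENNReal.ofReal_le_ofReal_iff dist_nonneg, dist_comm] at hxy
  · have hlt : Metric.infEDist x Θ < ENNReal.ofReal (R + ε) := by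
      rw [hdist]
      exact (ENNReal.ofReal_lt_ofReal_iff (by linarith)).2 (by linarith)
    obtain ⟨z, hz, hxz⟩ := Metric.infEDist_lt_iff.1 hlt
    have hyz : edist y z ≤ ENNReal.ofReal R := (Metric.edist_le_ediam_of_mem hy hz).trans hdiam
    rw [edist_dist, ENNReal.ofReal_lt_ofReal_iff (by linarith)] at hxz
    rw [edist_dist, ENNReal.ofReal_le_ofReal_iff hR.le] at hyz
    linarith [dist_triangle y z x, dist_comm z x]

lemma memLp_weakLaplacian (hG : IsOpen G) (hψ : MemSobolevTwo G 2 ψ)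
    (hlap : ∀ᵐ y ∂(volume.restrict G), |weakLaplacian G ψ y| ≤ KV * |ψ y|) :
    MemLp (weakLaplacian G ψ) 2 (volume.restrict G) := by
  refine (hψ.1.const_mul KV).mono (aestronglyMeasurable_weakLaplacian hG hψ) ?_
  filter_upwards [hlap] with y hy
  simpa using hy.trans (mul_le_mul_of_nonneg_right (le_abs_self KV) (abs_nonneg _))

lemma ae_indicator_weakLaplacian_sq_le (hG : IsOpen G) (hUG : U ⊆ G)
    (hlap : ∀ᵐ y ∂(volume.restrict G), |weakLaplacian G ψ y| ≤ KV * |ψ y|)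
    (a : EuclideanSpace ℝ (Fin d)) :
    ∀ᵐ y, U.indicator (weakLaplacian G ψ) (a + y) ^ 2
      ≤ KV ^ 2 * U.indicator ψ (a + y) ^ 2 := by
  refine (measurePreserving_add_left volume a).quasiMeasurePreserving.ae
    (p := fun z => U.indicator (weakLaplacian G ψ) z ^ 2 ≤ KV ^ 2 * U.indicator ψ z ^ 2) ?_
  filter_upwards [(ae_restrict_iff' hG.measurableSet).1 hlap] with z hz
  by_cases hzU : z ∈ U
  · simpa [hzU, mul_pow] using pow_le_pow_left₀ (abs_nonneg _) (hz (hUG hzU)) 2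
  · simp [hzU]

theorem carleman_differential_inequality_weakLaplacian (d : ℕ) : ∃ C : ℝ, 0 ≤ C ∧
    ∀ (G : Set (EuclideanSpace ℝ (Fin d))) (x : EuclideanSpace ℝ (Fin d))
      (ψ : EuclideanSpace ℝ (Fin d) → ℝ) (KV R l α : ℝ),
      IsOpen G → Metric.ball x (12 * R) ⊆ G → MemSobolevTwo G 2 ψ →
      (∀ᵐ y ∂(volume.restrict G), |weakLaplacian G ψ y| ≤ KV * |ψ y|) →
      0 < R → 0 < l → 11 / 10 * l ≤ R → 2 ≤ α → 24 ^ 5 * KV ^ 2 * R ^ 4 ≤ α ^ 3 →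
      α ^ 3 * carlemanWeight α (24 * R) (2 * R) / (96 * R ^ 2)
          * sqNorm {y | R ≤ dist y x ∧ dist y x ≤ 2 * R} ψ
        ≤ (1 + KV ^ 2 * l ^ 4) * (C * carlemanWeight α (24 * R) l / l ^ 2
            * sqNorm (Metric.closedBall x (121 / 100 * l)) ψ)
          + (1 + KV ^ 2 * (9 * R) ^ 4) * (C * carlemanWeight α (24 * R) (9 * R) / (9 * R) ^ 2
            * sqNorm (Metric.closedBall x (121 / 100 * (9 * R))) ψ) := by
  obtain ⟨C, hC, hcarleman⟩ := carleman_differential_inequality d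
  refine ⟨C, hC, fun G x ψ KV R l α hG hball hψ hlap hR hl hlR hα hαV => ?_⟩
  have hU : MeasurableSet (Metric.ball x (12 * R)) := measurableSet_ball
  have hdistrib :=
    ((hasDistribLaplacianOn_weakLaplacian hG hψ).mono hball).indicator.comp_add_left x
  rw [preimage_add_ball, sub_self] at hdistrib
  have hlocal := hcarleman _ _ KV R l α hR hl hlR hα hαV
    (memLp_indicator_comp_add_left hψ.1 hU hball x)
    (memLp_indicator_comp_add_left (memLp_weakLaplacian hG hψ hlap) hU hball x)
    (ae_indicator_weakLaplacian_sq_le hG hball hlap x) hdistrib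
  have hclosedBall : ∀ r < 12 * R,
      ∫ y in Metric.closedBall 0 r, (Metric.ball x (12 * R)).indicator ψ (x + y) ^ 2
        = sqNorm (Metric.closedBall x r) ψ := fun r hr => by
    rw [← sqNorm_indicator_comp_add_left ψ measurableSet_closedBall
      (Metric.closedBall_subset_ball hr) x, preimage_add_closedBall, sub_self, sqNorm]
  have hshell : ∫ y in {y | R ≤ ‖y‖ ∧ ‖y‖ ≤ 2 * R},
      (Metric.ball x (12 * R)).indicator ψ (x + y) ^ 2
        = sqNorm {y | R ≤ dist y x ∧ dist y x ≤ 2 * R} ψ := by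
    have hmeas : MeasurableSet {y | R ≤ dist y x ∧ dist y x ≤ 2 * R} :=
      (measurableSet_le measurable_const (measurable_id.dist measurable_const)).inter
        (measurableSet_le (measurable_id.dist measurable_const) measurable_const)
    rw [← sqNorm_indicator_comp_add_left ψ hmeas (U := Metric.ball x (12 * R))
      (fun y hy => Metric.mem_ball.2 (by linarith [hy.2])) x, sqNorm]
    simp only [Set.preimage_ofPred_eq, dist_self_add_left]
  rwa [hshell, hclosedBall _ (by linarith), hclosedBall _ (by linarith)] at hlocal

end Localization

section ExplicitBound

variable {C C₃ D KV R α α' β δ N₀ N₁ : ℝ}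

lemma thirtyOne_div_twentyFour_le_log : (31 / 24 : ℝ) ≤ Real.log (9 / 2) := by
  rw [Real.le_log_iff_exp_le (by norm_num)]
  have hexp : Real.exp (7 / 24) * (17 / 24) ≤ 1 := by
    have htangent := Real.add_one_le_exp (-(7 / 24 : ℝ))
    rw [Real.exp_neg, inv_eq_one_div, le_div_iff₀ (Real.exp_pos _)] at htangent
    linarith
  calc Real.exp (31 / 24) = Real.exp 1 * Real.exp (7 / 24) := by rw [← Real.exp_add]; norm_num
    _ ≤ 2.7182818286 * Real.exp (7 / 24) := by gcongr; exact Real.exp_one_lt_d9.le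
    _ ≤ 9 / 2 := by linarith

lemma carlemanWeight_outer_mul_exp_le (hα : 0 ≤ α) (hR : 0 < R) :
    carlemanWeight α (24 * R) (9 * R) * Real.exp (2 * α)
      ≤ carlemanWeight α (24 * R) (2 * R) := by
  unfold carlemanWeight
  rw [← Real.exp_add, Real.exp_le_exp]
  have hlog := thirtyOne_div_twentyFour_le_log
  rw [Real.log_div (by norm_num) (by norm_num)] at hlog
  rw [Real.log_mul (by norm_num) hR.ne', Real.log_mul (by norm_num) hR.ne',
    mul_div_mul_right _ _ hR.ne', mul_div_mul_right _ _ hR.ne']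
  nlinarith

lemma carlemanWeight_inner_mul_rpow_le (hα : 0 ≤ α) (hR : 0 < R) (hδ : 0 < δ)
    (hδR : δ < 4 * R) :
    carlemanWeight α (24 * R) (δ / 5) * (δ / (48 * R)) ^ (2 * α)
      ≤ carlemanWeight α (24 * R) (2 * R) := by
  unfold carlemanWeight
  rw [Real.rpow_def_of_pos (by positivity), ← Real.exp_add, Real.exp_le_exp,
    Real.log_div hδ.ne' (by norm_num : (5 : ℝ) ≠ 0),
    Real.log_div hδ.ne' (by positivity : 48 * R ≠ 0),
    Real.log_mul (by norm_num) hR.ne', Real.log_mul (by norm_num) hR.ne',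
    mul_div_mul_right _ _ hR.ne']
  have hratio : δ / 5 / (24 * R) ≤ 1 / 30 := by
    rw [div_le_iff₀ (by positivity)]
    linarith
  have hlog : Real.log 5 + Real.log 2 ≤ Real.log 48 := by
    rw [← Real.log_mul (by norm_num) (by norm_num)]
    exact Real.log_le_log (by norm_num) (by norm_num)
  nlinarith

/-- The lower bounds on the exponent `α` in the form in which they enter the estimates: `α³` absorbs
the potential in the Carleman estimate, and `e^{2α}` makes the outer cutoff error small compared to
the left-hand side. -/
def IsAbsorbingExponent (C₃ KV R β α : ℝ) : Prop :=
  2 ≤ α ∧ 24 ^ 5 * KV ^ 2 * R ^ 4 ≤ α ^ 3 ∧ C₃ * β ≤ Real.exp (2 * α)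

lemma AdmissibleExponent.isAbsorbingExponent (hC : 1 ≤ C₃) (hD : 0 < D) (hDR : D ≤ 12 * R)
    (h : AdmissibleExponent 2 C₃ 1 KV D R β α) : IsAbsorbingExponent C₃ KV R β α := by
  obtain ⟨hα, hpotential, hlog⟩ := h
  refine ⟨hα, ?_, ?_⟩
  · calc 24 ^ 5 * KV ^ 2 * R ^ 4 = 1 * (24 ^ 5 * KV ^ 2 * R ^ 4) := (one_mul _).symm
      _ ≤ C₃ * (24 ^ 5 * KV ^ 2 * R ^ 4) := by gcongr
      _ = ((24 ^ 5 * C₃ * KV ^ 2 * R ^ 4) ^ (1 / 3 : ℝ)) ^ 3 := by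
          rw [← Real.rpow_mul_natCast (by positivity)]
          norm_num
          ring
      _ ≤ α ^ 3 := by gcongr
  rcases le_or_gt β 0 with hβ | hβ
  · exact (mul_nonpos_of_nonneg_of_nonpos (by linarith) hβ).trans (Real.exp_pos _).le
  have hR : 0 < R := by linarith
  have hmin : 0 < min D 1 := lt_min hD one_pos
  have hradius : 1 ≤ (24 * R * 1 / D) ^ 4 :=
    one_le_pow₀ (by rw [le_div_iff₀ hD]; linarith)
  have hfactor : 1 ≤ (1 + KV ^ 2) / min D 1 ^ 2 := by
    rw [le_div_iff₀ (by positivity)]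
    nlinarith [sq_nonneg KV, min_le_right D 1]
  calc C₃ * β = 1 * C₃ * 1 * β := by ring
    _ ≤ (24 * R * 1 / D) ^ 4 * C₃ * ((1 + KV ^ 2) / min D 1 ^ 2) * β := by gcongr
    _ ≤ Real.exp (2 * α) := (Real.log_le_iff_le_exp (by positivity)).1 hlog

lemma exists_isLeast_isAbsorbingExponent (C₃ KV R β : ℝ) :
    ∃ α, IsLeast {α | IsAbsorbingExponent C₃ KV R β α} α := by
  have hclosed : IsClosed {α | IsAbsorbingExponent C₃ KV R β α} :=
    (isClosed_le continuous_const continuous_id).inter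
      ((isClosed_le continuous_const (continuous_pow 3)).inter
        (isClosed_le continuous_const (Real.continuous_exp.comp (continuous_const_mul 2))))
  have hexp : Tendsto (fun α : ℝ => Real.exp (2 * α)) atTop atTop :=
    Real.tendsto_exp_atTop.comp (tendsto_id.const_mul_atTop two_pos)
  have hnonempty : {α | IsAbsorbingExponent C₃ KV R β α}.Nonempty :=
    ((eventually_ge_atTop 2).and
      (((tendsto_pow_atTop three_ne_zero).eventually_ge_atTop _).and
        (hexp.eventually_ge_atTop _))).exists
  exact ⟨_, hclosed.isLeast_csInf hnonempty ⟨2, fun _ hα => hα.1⟩⟩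

lemma outer_cutoffError_le (hR : 0 < R) (hα : IsAbsorbingExponent C₃ KV R β α)
    (hC₃ : 100 * C ≤ C₃) (hβ : 0 ≤ β) (hN₀ : 0 ≤ N₀) :
    (1 + KV ^ 2 * (9 * R) ^ 4) * (C * carlemanWeight α (24 * R) (9 * R) / (9 * R) ^ 2 * (β * N₀))
      ≤ α ^ 3 * carlemanWeight α (24 * R) (2 * R) / (4050 * R ^ 2) * N₀ := by
  obtain ⟨hα₂, hpotential, hexp⟩ := hα
  have hw := carlemanWeight_pos α (24 * R) (9 * R)
  have hweight := carlemanWeight_outer_mul_exp_le (by linarith : 0 ≤ α) hR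
  have hcube : 2 ^ 3 ≤ α ^ 3 := by gcongr
  have hcoeff : 1 + KV ^ 2 * (9 * R) ^ 4 ≤ 2 * α ^ 3 := by
    nlinarith [show 0 ≤ KV ^ 2 * R ^ 4 by positivity]
  have hsmall : C * carlemanWeight α (24 * R) (9 * R) * β
      ≤ carlemanWeight α (24 * R) (2 * R) / 100 := by
    nlinarith [mul_le_mul_of_nonneg_right hC₃ hβ]
  calc _ = (1 + KV ^ 2 * (9 * R) ^ 4) * (C * carlemanWeight α (24 * R) (9 * R) * β)
        * (N₀ / (81 * R ^ 2)) := by ring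
    _ ≤ (1 + KV ^ 2 * (9 * R) ^ 4) * (carlemanWeight α (24 * R) (2 * R) / 100)
        * (N₀ / (81 * R ^ 2)) := by gcongr
    _ ≤ 2 * α ^ 3 * (carlemanWeight α (24 * R) (2 * R) / 100) * (N₀ / (81 * R ^ 2)) := by
        have hw₂ := carlemanWeight_pos α (24 * R) (2 * R)
        gcongr
    _ = _ := by ring

lemma inner_cutoffError_le (w : ℝ) (hw : 0 ≤ w) (hC : 100 * C ≤ C₃) (hC₀ : 0 ≤ C) (hδ : 0 < δ)
    (hδ₁ : δ ≤ 1) (hN₁ : 0 ≤ N₁) :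
    (1 + KV ^ 2 * (δ / 5) ^ 4) * (C * w / (δ / 5) ^ 2 * N₁)
      ≤ (1 + KV ^ 2) * C₃ / 4 * w / δ ^ 2 * N₁ := by
  have hpow : (δ / 5) ^ 4 ≤ 1 := pow_le_one₀ (by positivity) (by linarith)
  calc _ ≤ (1 + KV ^ 2 * 1) * (C * w / (δ / 5) ^ 2 * N₁) := by gcongr
    _ = (1 + KV ^ 2) * (100 * C) / 4 * w / δ ^ 2 * N₁ := by field_simp; ring
    _ ≤ _ := by gcongr

lemma explicitBound_pos (hC : 0 < C₃) (hR : 0 < R) (hδ : 0 < δ) :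
    0 < explicitBound 2 C₃ 1 KV R δ α := by
  unfold explicitBound
  positivity

lemma explicitBound_anti (hC : 0 < C₃) (hR : 0 < R) (hδ : 0 < δ) (hδR : δ < 4 * R)
    (h : α ≤ α') : explicitBound 2 C₃ 1 KV R δ α' ≤ explicitBound 2 C₃ 1 KV R δ α := by
  have hratio : δ / (48 * R) ≤ 1 := by
    rw [div_le_one (by positivity)]
    linarith
  have hpow : (δ / (48 * R)) ^ (2 * α') ≤ (δ / (48 * R)) ^ (2 * α) :=
    Real.rpow_le_rpow_of_exponent_ge (by positivity) hratio (by linarith)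
  unfold explicitBound
  gcongr

lemma explicitBound_mul_le (hC : 0 < C₃) (hR : 0 < R) (hδ : 0 < δ) (hδ₁ : δ ≤ 1) (hN₀ : 0 ≤ N₀)
    (h : 8 / 100 * (δ / (48 * R)) ^ (2 * α) / R ^ 2 * N₀ ≤ (1 + KV ^ 2) * C₃ / 4 / δ ^ 2 * N₁) :
    explicitBound 2 C₃ 1 KV R δ α * N₀ ≤ N₁ := by
  have hδ₄ : δ ^ 4 ≤ δ ^ 2 := pow_le_pow_of_le_one hδ.le hδ₁ (by norm_num)
  set Q := (δ / (48 * R)) ^ (2 * α) / R ^ 2 / ((1 + KV ^ 2) * C₃) * N₀ with hQ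
  calc explicitBound 2 C₃ 1 KV R δ α * N₀ = 5 / 82 * δ ^ 4 * Q := by
        rw [hQ, explicitBound]
        field_simp
        ring
    _ ≤ 8 / 25 * δ ^ 2 * Q := by gcongr ?_ * ?_ * Q; norm_num
    _ = 4 * δ ^ 2 / ((1 + KV ^ 2) * C₃)
          * (8 / 100 * (δ / (48 * R)) ^ (2 * α) / R ^ 2 * N₀) := by rw [hQ]; ring
    _ ≤ 4 * δ ^ 2 / ((1 + KV ^ 2) * C₃) * ((1 + KV ^ 2) * C₃ / 4 / δ ^ 2 * N₁) := by gcongr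
    _ = N₁ := by field_simp

lemma explicitBound_mul_le_of_carleman (hC₀ : 0 ≤ C) (hC : 100 * C ≤ C₃) (hC₃ : 0 < C₃)
    (hR : 0 < R) (hδ : 0 < δ) (hδ₁ : δ ≤ 1) (hδR : δ < 4 * R)
    (hα : IsAbsorbingExponent C₃ KV R β α) (hβ : 0 ≤ β) (hN₀ : 0 ≤ N₀) (hN₁ : 0 ≤ N₁)
    (h : α ^ 3 * carlemanWeight α (24 * R) (2 * R) / (96 * R ^ 2) * N₀
      ≤ (1 + KV ^ 2 * (δ / 5) ^ 4) * (C * carlemanWeight α (24 * R) (δ / 5) / (δ / 5) ^ 2 * N₁)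
        + (1 + KV ^ 2 * (9 * R) ^ 4) * (C * carlemanWeight α (24 * R) (9 * R) / (9 * R) ^ 2
          * (β * N₀))) :
    explicitBound 2 C₃ 1 KV R δ α * N₀ ≤ N₁ := by
  have houter := outer_cutoffError_le hR hα hC hβ hN₀
  have hw₁ := carlemanWeight_pos α (24 * R) (δ / 5)
  have hinner := inner_cutoffError_le (KV := KV) _ hw₁.le hC hC₀ hδ hδ₁ hN₁
  have hα₂ := hα.1
  have hcube : 2 ^ 3 ≤ α ^ 3 := by gcongr
  have hweight := carlemanWeight_inner_mul_rpow_le (by linarith : 0 ≤ α) hR hδ hδR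
  have hw₂ := carlemanWeight_pos α (24 * R) (2 * R)
  set w₁ := carlemanWeight α (24 * R) (δ / 5)
  set w₂ := carlemanWeight α (24 * R) (2 * R)
  have hmain : α ^ 3 * w₂ / (100 * R ^ 2) * N₀ ≤ (1 + KV ^ 2) * C₃ / 4 * w₁ / δ ^ 2 * N₁ := by
    have hM : 0 ≤ α ^ 3 * w₂ / R ^ 2 * N₀ := by positivity
    calc α ^ 3 * w₂ / (100 * R ^ 2) * N₀ = 1 / 100 * (α ^ 3 * w₂ / R ^ 2 * N₀) := by ring
      _ ≤ (1 / 96 - 1 / 4050) * (α ^ 3 * w₂ / R ^ 2 * N₀) :=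
          mul_le_mul_of_nonneg_right (by norm_num) hM
      _ = α ^ 3 * w₂ / (96 * R ^ 2) * N₀ - α ^ 3 * w₂ / (4050 * R ^ 2) * N₀ := by ring
      _ ≤ _ := by linarith
  refine explicitBound_mul_le hC₃ hR hδ hδ₁ hN₀ (le_of_mul_le_mul_left ?_ hw₁)
  calc w₁ * (8 / 100 * (δ / (48 * R)) ^ (2 * α) / R ^ 2 * N₀)
      = 2 ^ 3 * (w₁ * (δ / (48 * R)) ^ (2 * α)) / (100 * R ^ 2) * N₀ := by ring
    _ ≤ α ^ 3 * w₂ / (100 * R ^ 2) * N₀ := by gcongr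
    _ ≤ _ := hmain
    _ = _ := by ring

end ExplicitBound

theorem explicitBound_mul_sqNorm_le (d : ℕ) : ∃ C₃ : ℝ, 1 ≤ C₃ ∧
    ∀ KV R β δ α : ℝ, 0 < δ → δ ≤ 1 → δ < 4 * R → IsAbsorbingExponent C₃ KV R β α →
      ∀ (G : Set (EuclideanSpace ℝ (Fin d))) (x : EuclideanSpace ℝ (Fin d))
        (Θ : Set (EuclideanSpace ℝ (Fin d))) (ψ : EuclideanSpace ℝ (Fin d) → ℝ),
        IsOpen G → Metric.ediam Θ ≤ ENNReal.ofReal R →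
        Metric.infEDist x Θ = ENNReal.ofReal R → Metric.ball x (12 * R) ⊆ G →
        MemSobolevTwo G 2 ψ →
        (∀ᵐ y ∂(volume.restrict G), |weakLaplacian G ψ y| ≤ KV * |ψ y|) →
        sqNorm G ψ / sqNorm Θ ψ ≤ β →
        explicitBound 2 C₃ 1 KV R δ α * sqNorm Θ ψ ≤ sqNorm (Metric.ball x δ) ψ := by
  obtain ⟨C, hC, hcarleman⟩ := carleman_differential_inequality_weakLaplacian d
  refine ⟨1 + 100 * C, by linarith, fun KV R β δ α hδ hδ₁ hδR hα G x Θ ψ hG hdiam hdist hball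
    hψ hlap hβ => ?_⟩
  have hR : 0 < R := by linarith
  have hβ₀ : 0 ≤ β := (div_nonneg (sqNorm_nonneg G ψ) (sqNorm_nonneg Θ ψ)).trans hβ
  rcases (sqNorm_nonneg Θ ψ).eq_or_lt with hΘ₀ | hΘ_pos
  · rw [← hΘ₀, mul_zero]
    exact sqNorm_nonneg _ _
  have hestimate := hcarleman G x ψ KV R (δ / 5) α hG hball hψ hlap hR (by positivity)
    (by linarith) hα.1 hα.2.1
  have hshell : sqNorm Θ ψ ≤ sqNorm {y | R ≤ dist y x ∧ dist y x ≤ 2 * R} ψ :=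
    sqNorm_mono hψ.1 (subset_shell_of_infEDist_eq hR hdiam hdist) fun y hy =>
      hball (Metric.mem_ball.2 (by linarith [hy.2]))
  have hinner : sqNorm (Metric.closedBall x (121 / 100 * (δ / 5))) ψ
      ≤ sqNorm (Metric.ball x δ) ψ :=
    sqNorm_mono hψ.1 (Metric.closedBall_subset_ball (by linarith))
      ((Metric.ball_subset_ball (by linarith)).trans hball)
  have houter : sqNorm (Metric.closedBall x (121 / 100 * (9 * R))) ψ ≤ β * sqNorm Θ ψ :=
    (sqNorm_mono hψ.1 ((Metric.closedBall_subset_ball (by linarith)).trans hball)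
      subset_rfl).trans ((div_le_iff₀ hΘ_pos).1 hβ)
  have hw := carlemanWeight_pos α (24 * R)
  refine explicitBound_mul_le_of_carleman hC (by linarith) (by linarith) hR hδ hδ₁ hδR hα hβ₀
    hΘ_pos.le (sqNorm_nonneg _ ψ) ?_
  calc _ ≤ α ^ 3 * carlemanWeight α (24 * R) (2 * R) / (96 * R ^ 2)
        * sqNorm {y | R ≤ dist y x ∧ dist y x ≤ 2 * R} ψ := by
        have hα₂ := hα.1
        have hw₂ := hw (2 * R)
        gcongr
    _ ≤ _ := hestimate
    _ ≤ _ := by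
        have hw₁ := hw (δ / 5)
        have hw₉ := hw (9 * R)
        gcongr

theorem theorem3p1_general :
    ∃ KΔ : ℝ, 0 < KΔ ∧ ∀ d : ℕ, ∃ C₂ C₃ : ℝ, 1 ≤ C₂ ∧ 1 ≤ C₃ ∧
      ∀ KV R β δ : ℝ, 0 < δ → δ ≤ 1 → δ < 4 * R →
        ∃ C : ℝ, 0 < C ∧
          (∀ D α : ℝ, 0 < D → D ≤ 12 * R → AdmissibleExponent C₂ C₃ KΔ KV D R β α →
            explicitBound C₂ C₃ KΔ KV R δ α ≤ C) ∧
          ∀ (G : Set (EuclideanSpace ℝ (Fin d))) (x : EuclideanSpace ℝ (Fin d))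
            (Θ : Set (EuclideanSpace ℝ (Fin d))) (ψ : EuclideanSpace ℝ (Fin d) → ℝ),
            IsOpen G → Metric.ediam Θ ≤ ENNReal.ofReal R →
            Metric.infEDist x Θ = ENNReal.ofReal R → Metric.ball x (12 * R) ⊆ G →
            MemSobolevTwo G 2 ψ →
            (∀ᵐ y ∂(volume.restrict G), |weakLaplacian G ψ y| ≤ KV * |ψ y|) →
            sqNorm G ψ / sqNorm Θ ψ ≤ β →
            C * sqNorm Θ ψ ≤ sqNorm (Metric.ball x δ) ψ := by
  refine ⟨1, one_pos, fun d => ?_⟩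
  obtain ⟨C₃, hC₃, hcontinuation⟩ := explicitBound_mul_sqNorm_le d
  refine ⟨2, C₃, one_le_two, hC₃, fun KV R β δ hδ hδ₁ hδR => ?_⟩
  have hC₃_pos : 0 < C₃ := by linarith
  have hR : 0 < R := by linarith
  obtain ⟨α₀, hα₀, hα₀_le⟩ := exists_isLeast_isAbsorbingExponent C₃ KV R β
  exact ⟨explicitBound 2 C₃ 1 KV R δ α₀, explicitBound_pos hC₃_pos hR hδ,
    fun D α hD hDR hα => explicitBound_anti hC₃_pos hR hδ hδR
      (hα₀_le (hα.isAbsorbingExponent hC₃ hD hDR)),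
    hcontinuation KV R β δ α₀ hδ hδ₁ hδR hα₀⟩

lemma ae_le_mul_abs_of_le_abs_mul {d : ℕ} {G : Set (EuclideanSpace ℝ (Fin d))}
    {f V ψ : EuclideanSpace ℝ (Fin d) → ℝ} {KV : ℝ} (hG : MeasurableSet G)
    (hV : ∀ y ∈ G, |V y| ≤ KV) (hf : ∀ᵐ y ∂(volume.restrict G), f y ≤ |V y * ψ y|) :
    ∀ᵐ y ∂(volume.restrict G), f y ≤ KV * |ψ y| := by
  filter_upwards [hf, ae_restrict_mem hG] with y hy hyG
  exact hy.trans (abs_mul (V y) (ψ y) ▸ mul_le_mul_of_nonneg_right (hV y hyG) (abs_nonneg _))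

theorem theorem3p1 :
    ∃ KΔ : ℝ, 0 < KΔ ∧ ∀ d : ℕ, ∃ C₂ C₃ : ℝ, 1 ≤ C₂ ∧ 1 ≤ C₃ ∧
      ∀ KV D₀ R β δ : ℝ, 0 ≤ KV → 0 ≤ D₀ → 0 ≤ R → 0 ≤ β → 0 < δ → δ ≤ 1 → δ < 4 * R →
        ∃ C : ℝ, 0 < C ∧
          (0 < D₀ → ∀ α : ℝ, AdmissibleExponent C₂ C₃ KΔ KV (min D₀ (12 * R)) R β α →
            explicitBound C₂ C₃ KΔ KV R δ α ≤ C) ∧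
          ∀ (G : Set (EuclideanSpace ℝ (Fin d))) (x : EuclideanSpace ℝ (Fin d))
            (Θ : Set (EuclideanSpace ℝ (Fin d))) (V ψ : EuclideanSpace ℝ (Fin d) → ℝ),
            IsOpen G → x ∈ G → Θ ⊆ G → NullMeasurableSet Θ volume →
            Metric.ediam Θ ≤ ENNReal.ofReal R →
            Metric.infEDist x Θ = ENNReal.ofReal R →
            Metric.ball x (12 * R + 2 * D₀) ⊆ G →
            AEMeasurable V (volume.restrict G) → (∀ y ∈ G, |V y| ≤ KV) →
            MemSobolevTwo G 2 ψ →
            (∀ᵐ y ∂(volume.restrict G), |weakLaplacian G ψ y| ≤ |V y * ψ y|) →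
            sqNorm G ψ / sqNorm Θ ψ ≤ β →
            C * sqNorm Θ ψ ≤ sqNorm (Metric.ball x δ) ψ := by
  obtain ⟨KΔ, hKΔ, hgeneral⟩ := theorem3p1_general
  refine ⟨KΔ, hKΔ, fun d => ?_⟩
  obtain ⟨C₂, C₃, hC₂, hC₃, hdim⟩ := hgeneral d
  refine ⟨C₂, C₃, hC₂, hC₃, fun KV D₀ R β δ _ hD₀ _ _ hδ hδ₁ hδR => ?_⟩
  obtain ⟨C, hC, hexplicit, hcontinuation⟩ := hdim KV R β δ hδ hδ₁ hδR
  exact ⟨C, hC, fun hD₀_pos α => hexplicit _ α (lt_min hD₀_pos (by linarith)) (min_le_right _ _),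
    fun G x Θ V ψ hG _ _ _ hdiam hdist hball _ hV hψ hlap => hcontinuation G x Θ ψ hG hdiam hdist
      ((Metric.ball_subset_ball (by linarith)).trans hball) hψ
      (ae_le_mul_abs_of_le_abs_mul hG.measurableSet hV hlap)⟩
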